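/- Let $d\ge 1$, $\Omega\subseteq\mathbb{R}^d$ (Euclidean norm), and for a nonempty finite set $X\subseteq\Omega$ of $N=|X|$ points let $$q_X=\tfrac12\min_{x\ne y\in X}\|x-y\|,\qquad h_{X,\Omega}=\sup_{x\in\Omega}\min_{y\in X}\|x-y\|$$ be its separation radius and its fill distance. A *balanced binary tree* on $X$ is a binary tree of subsets of $X$ (clusters) with root $X$ in which every cluster $v$ either has no sons or is the disjoint union of two nonempty sons $s_1,s_2$ with $\big||s_1|-|s_2|\big|\le 2$ that are obtained by cutting along a longest edge of the bounding box of $v$ (the smallest axis-parallel box containing $v$): there are a direction $\ell$ of a longest edge and a number $m$ such that $x_\ell\ge m$ for $x\in s_1$ and $x_\ell\le m$ for $x\in s_2$. The splitting may stop according to any rule (for example, at a threshold for the cardinality or at a fixed depth). The level $j_v$ of a cluster $v$ is its distance from the root. 1. There is a constant $C_1=C_1(\Omega)>0$ such that, for every nonempty finite $X\subseteq\Omega$ with $N$ points, every balanced binary tree on $X$ and every cluster $v$ of it with at least two points, $$\operatorname{diam}(v)\ \ge\ C_1\,N^{1/d}\,q_X\,2^{-j_v/d}.$$ 2. If $\Omega$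 is bounded, then for every nonempty finite $X\subseteq\Omega$, every balanced binary tree on $X$ and every $j\ge 0$, $$\sum_{v\text{ is a cluster on level }j}\operatorname{diam}(v)\ \le\ 2\sqrt d\,\operatorname{diam}(\Omega)\,2^{\,j-j/d}.$$ 3. If $\Omega$ is convex and bounded, then for every $a\in\mathbb{R}$ there is a constant $C_3=C_3(\Omega,a)>0$ such that, for every nonempty finite $X\subseteq\Omega$ with $N$ points which satisfies $q_X\sim h_{X,\Omega}\sim N^{-1/d}$ with constant $a$, that is, $$q_X\le a\,h_{X,\Omega},\quad h_{X,\Omega}\le a\,q_X,\quad h_{X,\Omega}\le a\,N^{-1/d},\quad N^{-1/d}\le a\,h_{X,\Omega},$$ every balanced binary tree on $X$ and every cluster $v$ of it with at least two points, $$\operatorname{diam}(v)\ \le\ C_3\,2^{-j_v/d}.$$ -/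

import Mathlib

noncomputable section

/-- The separation radius `q_X`: half of the minimal distance between two distinct points of `X`. -/
def sepRadius {d : ℕ} (X : Finset (EuclideanSpace ℝ (Fin d))) : ℝ :=
  (1 / 2) * Set.infsep (X : Set (EuclideanSpace ℝ (Fin d)))

/-- The fill distance `h_{X,Ω}`: the supremum over `x ∈ Ω` of the distance from `x` to `X`. -/
def fillDist {d : ℕ} (X : Finset (EuclideanSpace ℝ (Fin d)))
    (Ω : Set (EuclideanSpace ℝ (Fin d))) : ℝ :=
  sSup ((fun x => Metric.infDist x (X : Set (EuclideanSpace ℝ (Fin d)))) '' Ω)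

/-- `x ∼ y` with constant `a`: each of the two numbers is at most `a` times the other. -/
def ComparableWith (a x y : ℝ) : Prop := x ≤ a * y ∧ y ≤ a * x

/-- The length of the edge in direction `i` of the bounding box of `v`
(the smallest axis-parallel box that contains `v`). -/
def boxEdge {d : ℕ} (v : Finset (EuclideanSpace ℝ (Fin d))) (i : Fin d) : ℝ :=
  sSup ((fun x : EuclideanSpace ℝ (Fin d) => x i) '' (v : Set (EuclideanSpace ℝ (Fin d)))) -
    sInf ((fun x : EuclideanSpace ℝ (Fin d) => x i) '' (v : Set (EuclideanSpace ℝ (Fin d))))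

/-- The splitting step: `v` is the disjoint union of the nonempty sons `s₁` and `s₂`, which are
separated by a hyperplane orthogonal to a longest edge of the bounding box of `v` (points on the
hyperplane may go to either side) and have nearly equal cardinality. The cardinalities may differ
by two, not only by one: this happens if `|v|` is even and the points of `v` on the median
hyperplane are put into `s₁` as long as `|s₁| ≤ |v| / 2`. -/
structure IsLongestEdgeSplit {d : ℕ} (v s₁ s₂ : Finset (EuclideanSpace ℝ (Fin d))) : Prop where
  nonempty₁ : s₁.Nonempty
  nonempty₂ : s₂.Nonempty
  disjoint : Disjoint s₁ s₂
  union : (s₁ : Set (EuclideanSpace ℝ (Fin d))) ∪ s₂ = v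
  card₁ : s₁.card ≤ s₂.card + 2
  card₂ : s₂.card ≤ s₁.card + 2
  separated : ∃ (i : Fin d) (m : ℝ), (∀ k, boxEdge v k ≤ boxEdge v i) ∧
    (∀ x ∈ s₁, m ≤ x i) ∧ (∀ x ∈ s₂, x i ≤ m)

/-- Binary trees in which every node carries a finite set of points (a cluster) and has either
no son or exactly two sons. -/
inductive ClusterTree (d : ℕ) : Type
  | leaf (v : Finset (EuclideanSpace ℝ (Fin d))) : ClusterTree d
  | node (v : Finset (EuclideanSpace ℝ (Fin d))) (t₁ t₂ : ClusterTree d) : ClusterTree d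

namespace ClusterTree

/-- The cluster at the root. -/
def root {d : ℕ} : ClusterTree d → Finset (EuclideanSpace ℝ (Fin d))
  | leaf v => v
  | node v _ _ => v

/-- The clusters on level `j`, that is, those reached from the root by `j` son relations. -/
def level {d : ℕ} : ClusterTree d → ℕ → Multiset (Finset (EuclideanSpace ℝ (Fin d)))
  | leaf v, 0 => {v}
  | leaf _, _ + 1 => 0
  | node v _ _, 0 => {v}
  | node _ t₁ t₂, j + 1 => level t₁ j + level t₂ j

/-- Every cluster that has sons arises from them by the splitting step. -/
def SplitsLongestEdges {d : ℕ} : ClusterTree d → Prop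
  | leaf _ => True
  | node v t₁ t₂ => IsLongestEdgeSplit v t₁.root t₂.root ∧
      t₁.SplitsLongestEdges ∧ t₂.SplitsLongestEdges

/-- `T` is a balanced binary tree on `X`, built from the root `X` by recursively splitting clusters
along a longest edge of their bounding box into two sons of nearly equal cardinality. No rule for
stopping is imposed: the recursion may end at a threshold for the cardinality, or at a prescribed
depth `J` (so that all leaves have level `J`), or in any other way. -/
structure IsBalancedTreeOn {d : ℕ} (T : ClusterTree d)
    (X : Finset (EuclideanSpace ℝ (Fin d))) : Prop where
  root_eq : T.root = X
  splits : T.SplitsLongestEdges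

end ClusterTree

end

/-! Lower bound. Halving makes a cluster `v` with at least two points on level `j` contain at least
`N / 2^(j+1)` points. The balls of radius `q_X` around them are disjoint and lie in a ball of radius
`diam v + q_X ≤ (3/2) diam v`; comparing volumes gives the claim (`le_diam`).

Sum of diameters. Only the longest-edge cuts matter. The diameter itself may hardly drop under one
cut, so it is replaced by `boxPotential`, whose sum over a level grows at most by the factor
`2^(1-1/d)` per level. The `d`-th root of the volume grows like that too, but it vanishes on flat
boxes; the floor in `sideFactor` repairs this, so that the potential still dominates the diameter up
to `2√d`.

Upper bound. Follow the convex cells cut out of the closure of `Ω` along the tree. A cell of bounded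
aspect ratio that is large compared with `h` contains a ball of comparable size, which is covered by
the balls of radius `h` around the points of `v`; hence `(diam v / h)^d` is bounded by a multiple of
`|v|`, while `|v| ≤ 5N / 2^j` and `h ≤ a N^(-1/d)`. Small cells are harmless because `2^j ≤ 2N`. The
difficulty is the aspect ratio, as a median hyperplane could run close to a face. By
`coordWidth_le_of_card_le` a fixed proportion of quasi-uniform points does not fit into a thin slab,
so the edge just cut stays comparable to the longest one. To carry this through later cuts in other
directions, shrink the earlier cell towards a central point of the present one
(`CoordCut.le_coordWidth`) and gain the directions one at a time (`pow_mul_le_of_forall_finset`). If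
the closure of `Ω` has no interior, its volume is zero, and packing bounds the number of
quasi-uniform points. -/

noncomputable section

/-! ### The box potential and its numerical inequalities -/

/-- The factor by which a relative edge length `x ∈ [0, 1]` enters the box potential. -/
def sideFactor (d : ℕ) (x : ℝ) : ℝ :=
  max ((2 : ℝ) ^ (1 - 1 / (d : ℝ)) - 1) (x ^ (1 / (d : ℝ)))

/-- A potential of a box with edge lengths `a i`: it dominates the diameter up to a constant, and
cutting a longest edge multiplies its total value by at most `2 ^ (1 - 1 / d)`. -/
def boxPotential {d : ℕ} (a : Fin d → ℝ) : ℝ :=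
  (⨆ i, a i) * ∏ i, sideFactor d (a i / ⨆ k, a k)

lemma one_le_two_rpow_one_sub_inv {d : ℕ} (hd : 1 ≤ d) : (1 : ℝ) ≤ 2 ^ (1 - 1 / (d : ℝ)) := by
  have h1 : (1 : ℝ) ≤ d := by exact_mod_cast hd
  apply Real.one_le_rpow (by norm_num)
  have : 1 / (d : ℝ) ≤ 1 := by rw [div_le_one (by linarith)]; exact h1
  linarith

lemma two_rpow_one_sub_inv_le_two {d : ℕ} : (2 : ℝ) ^ (1 - 1 / (d : ℝ)) ≤ 2 := by
  calc (2 : ℝ) ^ (1 - 1 / (d : ℝ)) ≤ 2 ^ (1 : ℝ) := by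
        apply Real.rpow_le_rpow_of_exponent_le (by norm_num)
        have : 0 ≤ 1 / (d : ℝ) := by positivity
        linarith
    _ = 2 := Real.rpow_one 2

lemma sideFactor_nonneg {d : ℕ} (hd : 1 ≤ d) (x : ℝ) : 0 ≤ sideFactor d x :=
  le_max_of_le_left (by linarith [one_le_two_rpow_one_sub_inv hd])

lemma sideFactor_one {d : ℕ} : sideFactor d 1 = 1 := by
  rw [sideFactor, Real.one_rpow, max_eq_right]
  linarith [two_rpow_one_sub_inv_le_two (d := d)]

lemma sideFactor_mono {d : ℕ} {x y : ℝ} (hx : 0 ≤ x) (hxy : x ≤ y) :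
    sideFactor d x ≤ sideFactor d y :=
  max_le_max le_rfl (Real.rpow_le_rpow hx hxy (by positivity))

lemma rpow_mean_le {θ : ℝ} (h0 : 0 ≤ θ) (h1 : θ ≤ 1) {t s : ℝ} (ht : 0 ≤ t) (hs : 0 ≤ s) :
    t ^ θ + s ^ θ ≤ 2 * ((t + s) / 2) ^ θ := by
  have := (Real.concaveOn_rpow h0 h1).2 (Set.mem_Ici.2 ht) (Set.mem_Ici.2 hs)
    (show (0 : ℝ) ≤ 1 / 2 by norm_num) (show (0 : ℝ) ≤ 1 / 2 by norm_num) (by norm_num)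
  simp only [smul_eq_mul] at this
  have e : (1 / 2 * t + 1 / 2 * s) = (t + s) / 2 := by ring
  rw [e] at this
  linarith

/-- Two powers are handled by concavity. The floor plus a power is at most the floor plus one, which
is exactly the right side and explains the value of the floor. Two floors fit because `2^(1-1/d) ≤
2`. -/
lemma sideFactor_add_le {d : ℕ} (hd : 1 ≤ d) {t s : ℝ} (ht : 0 ≤ t) (hs : 0 ≤ s)
    (hts : t + s ≤ 1) :
    sideFactor d t + sideFactor d s ≤ (2 : ℝ) ^ (1 - 1 / (d : ℝ)) := by
  have h1 : (1 : ℝ) ≤ d := by exact_mod_cast hd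
  have hp0 : 0 ≤ 1 / (d : ℝ) := by positivity
  have hp1 : 1 / (d : ℝ) ≤ 1 := by rw [div_le_one (by linarith)]; exact h1
  have h2 := two_rpow_one_sub_inv_le_two (d := d)
  have hs1 : s ^ (1 / (d : ℝ)) ≤ 1 := Real.rpow_le_one hs (by linarith) hp0
  have ht1 : t ^ (1 / (d : ℝ)) ≤ 1 := Real.rpow_le_one ht (by linarith) hp0
  have hJ : t ^ (1 / (d : ℝ)) + s ^ (1 / (d : ℝ)) ≤ (2 : ℝ) ^ (1 - 1 / (d : ℝ)) := by
    refine (rpow_mean_le hp0 hp1 ht hs).trans ?_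
    have : ((t + s) / 2) ^ (1 / (d : ℝ)) ≤ (1 / 2 : ℝ) ^ (1 / (d : ℝ)) :=
      Real.rpow_le_rpow (by positivity) (by linarith) hp0
    rw [Real.rpow_sub (by norm_num), Real.rpow_one]
    rw [Real.div_rpow zero_le_one zero_le_two, Real.one_rpow] at this
    rw [div_eq_mul_one_div 2 ((2 : ℝ) ^ (1 / (d : ℝ)))]
    linarith
  unfold sideFactor
  rcases max_cases ((2 : ℝ) ^ (1 - 1 / (d : ℝ)) - 1) (t ^ (1 / (d : ℝ))) with h | h <;>
  rcases max_cases ((2 : ℝ) ^ (1 - 1 / (d : ℝ)) - 1) (s ^ (1 / (d : ℝ))) with h' | h' <;>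
  rw [h.1, h'.1] <;> linarith

lemma rpow_mul_sideFactor_le {d : ℕ} (hd : 1 ≤ d) {m z : ℝ} (hm : 0 ≤ m) (hm1 : m ≤ 1)
    (hz : 0 ≤ z) : m ^ (1 / (d : ℝ)) * sideFactor d z ≤ sideFactor d (m * z) := by
  have hm' : 0 ≤ m ^ (1 / (d : ℝ)) := by positivity
  unfold sideFactor
  rw [mul_max_of_nonneg _ _ hm', Real.mul_rpow hm hz]
  refine max_le_max ?_ le_rfl
  exact mul_le_of_le_one_left (by linarith [one_le_two_rpow_one_sub_inv hd])
    (Real.rpow_le_one hm hm1 (by positivity))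

/-- An exponential in `a²` turns the product over all directions into a function of the mean square.
Below `17/100` the left side is monotone in `a`; above it, concavity puts `log` over its chord to
`1`. Both cases are nearly sharp at `a = 17/100`. -/
lemma exp_le_max_of_mem_Icc {a : ℝ} (h0 : 0 ≤ a) (h1 : a ≤ 1) :
    Real.exp (-(183 / 100) * (1 - a ^ 2)) ≤ max (17 / 100) a := by
  have hlog : -(71 / 40) ≤ Real.log (17 / 100) := by
    rw [Real.le_log_iff_exp_le (by norm_num), Real.exp_neg, inv_le_comm₀ (by positivity) (by norm_num)]
    have h := Real.exp_one_gt_d9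
    -- The 40th power reduces the claim to a comparison of rational numbers through decimal bounds
    -- for `e`.
    have h2 : (Real.exp (71 / 40)) ^ 40 = (Real.exp 1) ^ 71 := by
      rw [← Real.exp_nat_mul, ← Real.exp_nat_mul]; norm_num
    by_contra! hc
    have h3 : (Real.exp (71 / 40)) ^ 40 < ((17 / 100 : ℝ)⁻¹) ^ 40 :=
      pow_lt_pow_left₀ hc (by positivity) (by norm_num)
    have h4 : (2.7182818283 : ℝ) ^ 71 < (Real.exp 1) ^ 71 :=
      pow_lt_pow_left₀ h (by norm_num) (by norm_num)
    rw [h2] at h3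
    have h5 := h4.trans h3
    norm_num at h5
  rcases le_or_gt a (17 / 100) with h | h
  · refine le_max_of_le_left ?_
    rw [← Real.le_log_iff_exp_le (by norm_num)]
    nlinarith
  · refine le_max_of_le_right ?_
    rw [← Real.le_log_iff_exp_le (by linarith)]
    have hc := strictConcaveOn_log_Ioi.concaveOn.2
      (Set.mem_Ioi.2 (show (0 : ℝ) < 17 / 100 by norm_num)) (Set.mem_Ioi.2 zero_lt_one)
      (show 0 ≤ (1 - a) / (83 / 100) by apply div_nonneg <;> linarith)
      (show 0 ≤ (a - 17 / 100) / (83 / 100) by apply div_nonneg <;> linarith) (by ring)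
    simp only [smul_eq_mul, Real.log_one, mul_zero, add_zero] at hc
    have e : (1 - a) / (83 / 100) * (17 / 100) + (a - 17 / 100) / (83 / 100) * 1 = a := by ring
    rw [e] at hc
    refine le_trans ?_ hc
    have h3 : (1 - a) / (83 / 100) * (-(71 / 40)) ≤ (1 - a) / (83 / 100) * Real.log (17 / 100) :=
      mul_le_mul_of_nonneg_left hlog (by apply div_nonneg <;> linarith)
    refine le_trans ?_ h3
    nlinarith

/-- This is the square of `√y ≤ 2 exp(-1.83 (1 - y))`. The tangent inequality `e^u ≥ u + 1` at `u =
3.66 y - 1` reduces it to `e^2.66 ≤ 4 · 3.66`. -/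
lemma le_four_mul_exp (y : ℝ) (hy : 0 ≤ y) :
    y ≤ 4 * Real.exp (-(366 / 100) * (1 - y)) := by
  have h1 : Real.exp (133 / 50) ≤ 1464 / 100 := by
    have h := Real.exp_one_lt_d9
    have h2 : (Real.exp (133 / 50)) ^ 50 = (Real.exp 1) ^ 133 := by
      rw [← Real.exp_nat_mul, ← Real.exp_nat_mul]; norm_num
    by_contra! hc
    have h3 : ((1464 / 100 : ℝ)) ^ 50 < (Real.exp (133 / 50)) ^ 50 :=
      pow_lt_pow_left₀ hc (by positivity) (by norm_num)
    have h4 : (Real.exp 1) ^ 133 < (2.7182818286 : ℝ) ^ 133 :=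
      pow_lt_pow_left₀ h (by positivity) (by norm_num)
    rw [h2] at h3
    have h5 := h3.trans h4
    norm_num at h5
  have h2 : Real.exp (-(366 / 100) * (1 - y)) =
      Real.exp (366 / 100 * y - 1) / Real.exp (133 / 50) := by
    rw [← Real.exp_sub]; congr 1; ring
  rw [h2, mul_div_assoc', le_div_iff₀ (by positivity)]
  have h3 := Real.add_one_le_exp (366 / 100 * y - 1)
  nlinarith

/-- For `d = 2` the floor is `√2 - 1`, just above `√0.17`. Larger `d` follow from concavity of the
power `2/d`, applied to `1` and `√0.17`. -/
lemma rpow_max_le_sideFactor {d : ℕ} (hd : 2 ≤ d) (x : ℝ) :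
    (max (17 / 100) x) ^ (1 / (d : ℝ)) ≤ sideFactor d x := by
  have hd' : (2 : ℝ) ≤ d := by exact_mod_cast hd
  have hconst : (17 / 100 : ℝ) ^ (1 / (d : ℝ)) ≤ (2 : ℝ) ^ (1 - 1 / (d : ℝ)) - 1 := by
    have hθ0 : 0 ≤ 2 / (d : ℝ) := by positivity
    have hθ1 : 2 / (d : ℝ) ≤ 1 := by rw [div_le_one (by linarith)]; exact hd'
    have hJ := rpow_mean_le hθ0 hθ1 (t := 1) (s := √(17 / 100)) zero_le_one (by positivity)
    have e1 : (√(17 / 100 : ℝ)) ^ (2 / (d : ℝ)) = (17 / 100 : ℝ) ^ (1 / (d : ℝ)) := by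
      rw [Real.sqrt_eq_rpow, ← Real.rpow_mul (by norm_num)]; congr 1; ring
    have e2 : ((1 + √(17 / 100 : ℝ)) / 2) ^ (2 / (d : ℝ)) ≤ (1 / 2 : ℝ) ^ (1 / (d : ℝ)) := by
      have : (1 / 2 : ℝ) ^ (1 / (d : ℝ)) = (√(1 / 2)) ^ (2 / (d : ℝ)) := by
        rw [Real.sqrt_eq_rpow, ← Real.rpow_mul (by norm_num)]; congr 1; ring
      rw [this]
      refine Real.rpow_le_rpow (by positivity) ?_ hθ0
      have h1 : √(17 / 100 : ℝ) ≤ 4124 / 10000 := by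
        rw [Real.sqrt_le_left (by norm_num)]; norm_num
      have h2 : (7071 / 10000 : ℝ) ≤ √(1 / 2) := by
        apply Real.le_sqrt_of_sq_le; norm_num
      linarith
    rw [e1, Real.one_rpow] at hJ
    rw [Real.rpow_sub (by norm_num), Real.rpow_one]
    rw [Real.div_rpow zero_le_one zero_le_two, Real.one_rpow] at e2
    rw [div_eq_mul_one_div 2 ((2 : ℝ) ^ (1 / (d : ℝ)))]
    linarith
  unfold sideFactor
  rcases max_cases (17 / 100) x with h | h
  · rw [h.1]; exact le_max_of_le_left hconst
  · rw [h.1]; exact le_max_right _ _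

lemma sqrt_sum_sq_le_prod_sideFactor {d : ℕ} (hd : 1 ≤ d) (a : Fin d → ℝ) (h0 : ∀ i, 0 ≤ a i)
    (h1 : ∀ i, a i ≤ 1) (hmax : ∃ i, a i = 1) :
    √(∑ i, a i ^ 2) ≤ 2 * √d * ∏ i, sideFactor d (a i) := by
  -- For `d = 1` the floor is zero and the bound by `17/100` fails, but the only edge has length
  -- one.
  rcases hd.eq_or_lt with rfl | hd2
  · obtain ⟨i, hi⟩ := hmax
    rw [Subsingleton.elim i 0] at hi
    simp [hi, sideFactor_one]
  have hdpos : (0 : ℝ) < d := by exact_mod_cast (by omega : 0 < d)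
  set y : ℝ := (∑ i, a i ^ 2) / d with hy
  have hy0 : 0 ≤ y := by positivity
  have hprod : Real.exp (-(183 / 100) * (1 - y)) ≤ ∏ i, sideFactor d (a i) := by
    have : Real.exp (-(183 / 100) * (1 - y)) =
        ∏ i, (Real.exp (-(183 / 100) * (1 - a i ^ 2))) ^ (1 / (d : ℝ)) := by
      rw [Real.finsetProd_rpow _ _ (fun i _ => (Real.exp_pos _).le), ← Real.exp_sum,
        ← Real.exp_mul, ← Finset.mul_sum, Finset.sum_sub_distrib]
      congr 1
      simp only [Finset.sum_const, Finset.card_univ, Fintype.card_fin, nsmul_eq_mul, mul_one, hy]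
      field_simp
    rw [this]
    refine Finset.prod_le_prod (fun i _ => by positivity) fun i _ => ?_
    refine le_trans ?_ (rpow_max_le_sideFactor hd2 (a i))
    exact Real.rpow_le_rpow (by positivity) (exp_le_max_of_mem_Icc (h0 i) (h1 i)) (by positivity)
  have hs : √(∑ i, a i ^ 2) = √d * √y := by
    rw [← Real.sqrt_mul hdpos.le, hy]; congr 1; field_simp
  have hsy : √y ≤ 2 * Real.exp (-(183 / 100) * (1 - y)) := by
    rw [Real.sqrt_le_left (by positivity), mul_pow, ← Real.exp_nat_mul]
    refine (le_four_mul_exp y hy0).trans (le_of_eq ?_)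
    norm_num
    ring_nf
  rw [hs]
  calc √d * √y ≤ √d * (2 * ∏ i, sideFactor d (a i)) := by gcongr; linarith
    _ = _ := by ring

section Potential
variable {d : ℕ}

lemma boxPotential_nonneg (hd : 1 ≤ d) {a : Fin d → ℝ} (h0 : ∀ i, 0 ≤ a i) :
    0 ≤ boxPotential a :=
  mul_nonneg (Real.iSup_nonneg h0) (Finset.prod_nonneg fun _ _ => sideFactor_nonneg hd _)

lemma le_iSup_fin (a : Fin d → ℝ) (i : Fin d) : a i ≤ ⨆ k, a k :=
  le_ciSup (Set.finite_range a).bddAbove i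

lemma sqrt_sum_sq_le_boxPotential (hd : 1 ≤ d) {a : Fin d → ℝ} (h0 : ∀ i, 0 ≤ a i) :
    √(∑ i, a i ^ 2) ≤ 2 * √d * boxPotential a := by
  have : Nonempty (Fin d) := ⟨⟨0, hd⟩⟩
  obtain ⟨i₀, hi₀⟩ := exists_eq_ciSup_of_finite (f := a)
  unfold boxPotential
  rw [← hi₀]
  rcases (h0 i₀).eq_or_lt with h | h
  · have : ∀ i, a i = 0 := fun i => le_antisymm (by rw [h, hi₀]; exact le_iSup_fin a i) (h0 i)
    simp [this]
  · have := sqrt_sum_sq_le_prod_sideFactor hd (fun i => a i / a i₀)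
      (fun i => div_nonneg (h0 i) h.le)
      (fun i => by rw [div_le_one h, hi₀]; exact le_iSup_fin a i) ⟨i₀, div_self h.ne'⟩
    have e : √(∑ i, a i ^ 2) = a i₀ * √(∑ i, (a i / a i₀) ^ 2) := by
      simp only [div_pow]
      rw [← Finset.sum_div, Real.sqrt_div' _ (by positivity), Real.sqrt_sq h.le]
      field_simp
    rw [e]
    calc a i₀ * √(∑ i, (a i / a i₀) ^ 2)
        ≤ a i₀ * (2 * √d * ∏ i, sideFactor d (a i / a i₀)) := by gcongr
      _ = _ := by ring

lemma boxPotential_le_iSup (hd : 1 ≤ d) {a : Fin d → ℝ} (h0 : ∀ i, 0 ≤ a i) :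
    boxPotential a ≤ ⨆ i, a i := by
  have hM : 0 ≤ ⨆ i, a i := Real.iSup_nonneg h0
  refine mul_le_of_le_one_right hM ?_
  refine Finset.prod_le_one (fun i _ => sideFactor_nonneg hd _) fun i _ => ?_
  refine (sideFactor_mono (div_nonneg (h0 i) hM) (div_le_one_of_le₀ (le_iSup_fin a i) hM)).trans ?_
  rw [sideFactor_one]

/-- Normalizing by a larger length `M` only increases the expression: the lost factor `m = max a /
M` is spread as `m^(1/d)` over the `d` side factors. Thus both halves of a cut box can be measured
against the longest edge of the whole box. -/
lemma boxPotential_le (hd : 1 ≤ d) {a : Fin d → ℝ} (h0 : ∀ i, 0 ≤ a i) {M : ℝ} (hM : 0 < M)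
    (haM : ∀ i, a i ≤ M) : boxPotential a ≤ M * ∏ i, sideFactor d (a i / M) := by
  have : Nonempty (Fin d) := ⟨⟨0, hd⟩⟩
  have hdpos : (0 : ℝ) < d := by exact_mod_cast hd
  obtain ⟨i₀, hi₀⟩ := exists_eq_ciSup_of_finite (f := a)
  unfold boxPotential
  rw [← hi₀]
  have hRHS : 0 ≤ ∏ i, sideFactor d (a i / M) :=
    Finset.prod_nonneg fun i _ => sideFactor_nonneg hd _
  rcases (h0 i₀).eq_or_lt with h | h
  · rw [← h, zero_mul]; positivity
  set m : ℝ := a i₀ / M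
  have hm0 : 0 ≤ m := div_nonneg h.le hM.le
  have hm1 : m ≤ 1 := (div_le_one hM).2 (haM i₀)
  have hpow : m = ∏ _i : Fin d, m ^ (1 / (d : ℝ)) := by
    rw [Finset.prod_const, Finset.card_univ, Fintype.card_fin, ← Real.rpow_natCast,
      ← Real.rpow_mul hm0, one_div_mul_cancel hdpos.ne', Real.rpow_one]
  have hmul : m * ∏ i, sideFactor d (a i / a i₀) ≤ ∏ i, sideFactor d (a i / M) := by
    conv_lhs => rw [hpow]
    rw [← Finset.prod_mul_distrib]
    refine Finset.prod_le_prod (fun i _ => mul_nonneg (by positivity) (sideFactor_nonneg hd _))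
      fun i _ => ?_
    refine (rpow_mul_sideFactor_le hd hm0 hm1 (div_nonneg (h0 i) h.le)).trans (le_of_eq ?_)
    congr 1
    simp only [m]
    field_simp
  have e : a i₀ = M * m := by simp only [m]; field_simp
  calc a i₀ * ∏ i, sideFactor d (a i / a i₀) = M * (m * ∏ i, sideFactor d (a i / a i₀)) := by
        rw [← mul_assoc, ← e]
    _ ≤ _ := by gcongr

lemma boxPotential_add_le (hd : 1 ≤ d) {a b c : Fin d → ℝ} (hb : ∀ i, 0 ≤ b i)
    (hc : ∀ i, 0 ≤ c i) (hba : ∀ i, b i ≤ a i) (hca : ∀ i, c i ≤ a i) {i₀ : Fin d}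
    (hmax : ∀ i, a i ≤ a i₀) (hcut : b i₀ + c i₀ ≤ a i₀) :
    boxPotential b + boxPotential c ≤ (2 : ℝ) ^ (1 - 1 / (d : ℝ)) * boxPotential a := by
  have : Nonempty (Fin d) := ⟨i₀⟩
  have ha : ∀ i, 0 ≤ a i := fun i => (hb i).trans (hba i)
  have hsup : (⨆ i, a i) = a i₀ := le_antisymm (ciSup_le hmax) (le_iSup_fin a i₀)
  rcases (ha i₀).eq_or_lt with h | h
  · have hb' := boxPotential_le_iSup hd hb
    have hc' := boxPotential_le_iSup hd hc
    have h1 : (⨆ i, b i) ≤ 0 := ciSup_le fun i => (hba i).trans (h ▸ hmax i)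
    have h2 : (⨆ i, c i) ≤ 0 := ciSup_le fun i => (hca i).trans (h ▸ hmax i)
    have := mul_nonneg (by positivity : (0 : ℝ) ≤ (2 : ℝ) ^ (1 - 1 / (d : ℝ)))
      (boxPotential_nonneg hd ha)
    linarith
  set M := a i₀
  set R := ∏ i ∈ Finset.univ.erase i₀, sideFactor d (a i / M)
  have hR : 0 ≤ R := Finset.prod_nonneg fun i _ => sideFactor_nonneg hd _
  have key : ∀ e : Fin d → ℝ, (∀ i, 0 ≤ e i) → (∀ i, e i ≤ a i) →
      boxPotential e ≤ M * (sideFactor d (e i₀ / M) * R) := by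
    intro e he hea
    refine (boxPotential_le hd he h fun i => (hea i).trans (hmax i)).trans ?_
    rw [← Finset.mul_prod_erase _ _ (Finset.mem_univ i₀)]
    have := sideFactor_nonneg hd (e i₀ / M)
    have h2 : ∏ i ∈ Finset.univ.erase i₀, sideFactor d (e i / M) ≤ R :=
      Finset.prod_le_prod (fun _ _ => sideFactor_nonneg hd _) fun i _ =>
        sideFactor_mono (div_nonneg (he i) h.le) (by have := hea i; gcongr)
    gcongr
  have ea : boxPotential a = M * R := by
    unfold boxPotential
    rw [hsup, ← Finset.mul_prod_erase _ _ (Finset.mem_univ i₀), div_self h.ne', sideFactor_one,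
      one_mul]
  have hsum := sideFactor_add_le hd (div_nonneg (hb i₀) h.le) (div_nonneg (hc i₀) h.le)
    (by rw [← add_div]; exact (div_le_one h).2 hcut)
  rw [ea]
  calc boxPotential b + boxPotential c
      ≤ M * (sideFactor d (b i₀ / M) * R) + M * (sideFactor d (c i₀ / M) * R) :=
        add_le_add (key b hb hba) (key c hc hca)
    _ = M * R * (sideFactor d (b i₀ / M) + sideFactor d (c i₀ / M)) := by ring
    _ ≤ M * R * (2 : ℝ) ^ (1 - 1 / (d : ℝ)) := by gcongr
    _ = _ := by ring

end Potential
end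

/-! ### Coordinate widths and the splitting step -/

noncomputable section

/-- The length of the projection of `K` to the `i`-th coordinate axis. -/
def coordWidth {d : ℕ} (K : Set (EuclideanSpace ℝ (Fin d))) (i : Fin d) : ℝ :=
  sSup ((fun x : EuclideanSpace ℝ (Fin d) => x i) '' K) -
    sInf ((fun x : EuclideanSpace ℝ (Fin d) => x i) '' K)

section CoordWidth
variable {d : ℕ} {K K' : Set (EuclideanSpace ℝ (Fin d))} {i : Fin d}

lemma abs_coord_sub_le_dist (x y : EuclideanSpace ℝ (Fin d)) (i : Fin d) :
    |x i - y i| ≤ dist x y := by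
  rw [dist_eq_norm]
  simpa [Real.norm_eq_abs] using PiLp.norm_apply_le (x - y) i

lemma lipschitzWith_coord (i : Fin d) :
    LipschitzWith 1 (fun x : EuclideanSpace ℝ (Fin d) => x i) :=
  LipschitzWith.of_dist_le_mul fun x y => by
    simpa [Real.dist_eq] using abs_coord_sub_le_dist x y i

lemma isBounded_coord_image (hK : Bornology.IsBounded K) (i : Fin d) :
    Bornology.IsBounded ((fun x : EuclideanSpace ℝ (Fin d) => x i) '' K) :=
  (lipschitzWith_coord i).isBounded_image hK

lemma sub_le_coordWidth (hK : Bornology.IsBounded K) {x y : EuclideanSpace ℝ (Fin d)}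
    (hx : x ∈ K) (hy : y ∈ K) : x i - y i ≤ coordWidth K i :=
  sub_le_sub (le_csSup (isBounded_coord_image hK i).bddAbove ⟨x, hx, rfl⟩)
    (csInf_le (isBounded_coord_image hK i).bddBelow ⟨y, hy, rfl⟩)

lemma abs_sub_le_coordWidth (hK : Bornology.IsBounded K) {x y : EuclideanSpace ℝ (Fin d)}
    (hx : x ∈ K) (hy : y ∈ K) : |x i - y i| ≤ coordWidth K i :=
  abs_sub_le_iff.2 ⟨sub_le_coordWidth hK hx hy, sub_le_coordWidth hK hy hx⟩

lemma exists_sub_eq_coordWidth (hK : IsCompact K) (hne : K.Nonempty) (i : Fin d) :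
    ∃ x ∈ K, ∃ y ∈ K, (∀ z ∈ K, y i ≤ z i ∧ z i ≤ x i) ∧ x i - y i = coordWidth K i := by
  have hc : ContinuousOn (fun x : EuclideanSpace ℝ (Fin d) => x i) K :=
    (lipschitzWith_coord i).continuous.continuousOn
  obtain ⟨x, hx, hx1, hx2⟩ := hK.exists_sSup_image_eq_and_ge hne hc
  obtain ⟨y, hy, hy1, hy2⟩ := hK.exists_sInf_image_eq_and_le hne hc
  exact ⟨x, hx, y, hy, fun z hz => ⟨hy2 z hz, hx2 z hz⟩, by rw [coordWidth, hx1, hy1]⟩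

lemma coordWidth_nonneg (hK : Bornology.IsBounded K) (hne : K.Nonempty) :
    0 ≤ coordWidth K i := by
  obtain ⟨x, hx⟩ := hne
  simpa using sub_le_coordWidth (i := i) hK hx hx

lemma coordWidth_mono (hK' : Bornology.IsBounded K') (hne : K.Nonempty) (h : K ⊆ K') :
    coordWidth K i ≤ coordWidth K' i :=
  sub_le_sub
    (csSup_le_csSup (isBounded_coord_image hK' i).bddAbove (hne.image _) (Set.image_mono h))
    (csInf_le_csInf (isBounded_coord_image hK' i).bddBelow (hne.image _) (Set.image_mono h))

lemma coordWidth_le_diam (hK : IsCompact K) (hne : K.Nonempty) :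
    coordWidth K i ≤ Metric.diam K := by
  obtain ⟨x, hx, y, hy, -, h⟩ := exists_sub_eq_coordWidth hK hne i
  rw [← h]
  exact (le_abs_self _).trans ((abs_coord_sub_le_dist x y i).trans
    (Metric.dist_le_diam_of_mem hK.isBounded hx hy))

lemma diam_le_sqrt_sum_coordWidth (hK : Bornology.IsBounded K) :
    Metric.diam K ≤ √(∑ i, coordWidth K i ^ 2) := by
  refine Metric.diam_le_of_forall_dist_le (by positivity) fun x hx y hy => ?_
  rw [EuclideanSpace.dist_eq]
  refine Real.sqrt_le_sqrt (Finset.sum_le_sum fun i _ => ?_)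
  rw [Real.dist_eq]
  exact pow_le_pow_left₀ (abs_nonneg _) (abs_sub_le_coordWidth hK hx hy) 2

lemma boxEdge_eq_coordWidth (v : Finset (EuclideanSpace ℝ (Fin d))) (i : Fin d) :
    boxEdge v i = coordWidth (v : Set (EuclideanSpace ℝ (Fin d))) i := rfl

lemma boxEdge_nonneg {v : Finset (EuclideanSpace ℝ (Fin d))} (hv : v.Nonempty) (i : Fin d) :
    0 ≤ boxEdge v i :=
  coordWidth_nonneg v.finite_toSet.isBounded hv

end CoordWidth

section Split
variable {d : ℕ} {v s₁ s₂ : Finset (EuclideanSpace ℝ (Fin d))}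

lemma IsLongestEdgeSplit.subset₁ (h : IsLongestEdgeSplit v s₁ s₂) : s₁ ⊆ v := by
  intro x hx
  have : x ∈ (v : Set (EuclideanSpace ℝ (Fin d))) := by rw [← h.union]; exact Or.inl hx
  exact this

lemma IsLongestEdgeSplit.subset₂ (h : IsLongestEdgeSplit v s₁ s₂) : s₂ ⊆ v := by
  intro x hx
  have : x ∈ (v : Set (EuclideanSpace ℝ (Fin d))) := by rw [← h.union]; exact Or.inr hx
  exact this

lemma IsLongestEdgeSplit.card_add (h : IsLongestEdgeSplit v s₁ s₂) :
    s₁.card + s₂.card = v.card := by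
  classical
  rw [← Finset.card_union_of_disjoint h.disjoint]
  congr 1
  rw [← Finset.coe_inj, Finset.coe_union, h.union]

lemma IsLongestEdgeSplit.boxPotential_add_le (hd : 1 ≤ d) (h : IsLongestEdgeSplit v s₁ s₂) :
    boxPotential (boxEdge s₁) + boxPotential (boxEdge s₂) ≤
      (2 : ℝ) ^ (1 - 1 / (d : ℝ)) * boxPotential (boxEdge v) := by
  obtain ⟨i, m, hi, h1, h2⟩ := h.separated
  have hb := v.finite_toSet.isBounded
  refine _root_.boxPotential_add_le hd (boxEdge_nonneg h.nonempty₁) (boxEdge_nonneg h.nonempty₂)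
    (fun k => coordWidth_mono hb h.nonempty₁ h.subset₁)
    (fun k => coordWidth_mono hb h.nonempty₂ h.subset₂) hi ?_
  obtain ⟨x, hx, y, hy, -, e1⟩ :=
    exists_sub_eq_coordWidth s₁.finite_toSet.isCompact h.nonempty₁ i
  obtain ⟨x', hx', y', hy', -, e2⟩ :=
    exists_sub_eq_coordWidth s₂.finite_toSet.isCompact h.nonempty₂ i
  have := sub_le_coordWidth (i := i) hb (h.subset₁ hx) (h.subset₂ hy')
  rw [boxEdge_eq_coordWidth, boxEdge_eq_coordWidth, boxEdge_eq_coordWidth, ← e1, ← e2]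
  have a1 := h1 y hy
  have a2 := h2 x' hx'
  linarith

end Split

/-! ### Level sums and cardinalities in the tree -/

namespace ClusterTree
variable {d : ℕ} {T : ClusterTree d}

lemma SplitsLongestEdges.subset_root (hT : T.SplitsLongestEdges) :
    ∀ {j : ℕ} {v : Finset (EuclideanSpace ℝ (Fin d))}, v ∈ T.level j → v ⊆ T.root := by
  induction T with
  | leaf u =>
    intro j v hv
    cases j with
    | zero => rw [Multiset.mem_singleton.1 hv]; exact subset_rfl
    | succ j => simp [level] at hv
  | node u t₁ t₂ ih₁ ih₂ =>
    intro j v hv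
    cases j with
    | zero => rw [Multiset.mem_singleton.1 hv]; exact subset_rfl
    | succ j =>
      rcases Multiset.mem_add.1 hv with h | h
      · exact (ih₁ hT.2.1 h).trans hT.1.subset₁
      · exact (ih₂ hT.2.2 h).trans hT.1.subset₂

lemma SplitsLongestEdges.sum_boxPotential_le (hd : 1 ≤ d) (hT : T.SplitsLongestEdges)
    (hne : T.root.Nonempty) (j : ℕ) :
    ((T.level j).map fun v => boxPotential (boxEdge v)).sum ≤
      ((2 : ℝ) ^ (1 - 1 / (d : ℝ))) ^ j * boxPotential (boxEdge T.root) := by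
  induction T generalizing j with
  | leaf u =>
    have h0 := boxPotential_nonneg hd (boxEdge_nonneg (v := u) hne)
    cases j with
    | zero => simp [level, root]
    | succ j => simp only [level, root, Multiset.map_zero, Multiset.sum_zero]; positivity
  | node u t₁ t₂ ih₁ ih₂ =>
    cases j with
    | zero => simp [level, root]
    | succ j =>
      simp only [level, root, Multiset.map_add, Multiset.sum_add]
      have h1 := ih₁ hT.2.1 hT.1.nonempty₁ j
      have h2 := ih₂ hT.2.2 hT.1.nonempty₂ j
      have h3 := hT.1.boxPotential_add_le hd
      calc _ ≤ ((2 : ℝ) ^ (1 - 1 / (d : ℝ))) ^ j *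
            (boxPotential (boxEdge t₁.root) + boxPotential (boxEdge t₂.root)) := by
            rw [mul_add]; exact add_le_add h1 h2
        _ ≤ ((2 : ℝ) ^ (1 - 1 / (d : ℝ))) ^ j *
            ((2 : ℝ) ^ (1 - 1 / (d : ℝ)) * boxPotential (boxEdge u)) := by gcongr
        _ = _ := by ring

lemma SplitsLongestEdges.nonempty (hT : T.SplitsLongestEdges) (hne : T.root.Nonempty) :
    ∀ {j : ℕ} {v : Finset (EuclideanSpace ℝ (Fin d))}, v ∈ T.level j → v.Nonempty := by
  induction T with
  | leaf u =>
    intro j v hv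
    cases j with
    | zero => rwa [Multiset.mem_singleton.1 hv]
    | succ j => simp [level] at hv
  | node u t₁ t₂ ih₁ ih₂ =>
    intro j v hv
    cases j with
    | zero => rwa [Multiset.mem_singleton.1 hv]
    | succ j =>
      rcases Multiset.mem_add.1 hv with h | h
      · exact ih₁ hT.2.1 hT.1.nonempty₁ h
      · exact ih₂ hT.2.2 hT.1.nonempty₂ h

lemma SplitsLongestEdges.sum_diam_le (hd : 1 ≤ d) (hT : T.SplitsLongestEdges)
    (hne : T.root.Nonempty) {Ω : Set (EuclideanSpace ℝ (Fin d))} (hΩ : Bornology.IsBounded Ω)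
    (hX : (T.root : Set (EuclideanSpace ℝ (Fin d))) ⊆ Ω) (j : ℕ) :
    ((T.level j).map
      (fun v : Finset (EuclideanSpace ℝ (Fin d)) =>
        Metric.diam (v : Set (EuclideanSpace ℝ (Fin d))))).sum ≤
      2 * √(d : ℝ) * Metric.diam Ω * (2 : ℝ) ^ ((j : ℝ) - (j : ℝ) / (d : ℝ)) := by
  have : Nonempty (Fin d) := ⟨⟨0, hd⟩⟩
  have h1 : ((T.level j).map
      (fun v : Finset (EuclideanSpace ℝ (Fin d)) =>
        Metric.diam (v : Set (EuclideanSpace ℝ (Fin d))))).sum ≤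
      ((T.level j).map fun v => 2 * √(d : ℝ) * boxPotential (boxEdge v)).sum :=
    Multiset.sum_map_le_sum_map _ _ fun v hv =>
      (diam_le_sqrt_sum_coordWidth v.finite_toSet.isBounded).trans
        (sqrt_sum_sq_le_boxPotential hd (boxEdge_nonneg (hT.nonempty hne hv)))
  rw [Multiset.sum_map_mul_left] at h1
  have h2 := hT.sum_boxPotential_le hd hne j
  have h3 : boxPotential (boxEdge T.root) ≤ Metric.diam Ω := by
    refine (boxPotential_le_iSup hd (boxEdge_nonneg hne)).trans (ciSup_le fun i => ?_)
    exact (coordWidth_le_diam T.root.finite_toSet.isCompact hne).trans (Metric.diam_mono hX hΩ)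
  have e : ((2 : ℝ) ^ (1 - 1 / (d : ℝ))) ^ j = (2 : ℝ) ^ ((j : ℝ) - (j : ℝ) / (d : ℝ)) := by
    rw [← Real.rpow_natCast, ← Real.rpow_mul (by norm_num)]; congr 1; ring
  rw [e] at h2
  calc _ ≤ 2 * √(d : ℝ) * ((2 : ℝ) ^ ((j : ℝ) - (j : ℝ) / (d : ℝ)) * Metric.diam Ω) := by
        refine h1.trans ?_
        gcongr
        exact h2.trans (by gcongr)
    _ = _ := by ring

/-- A difference of at most two between the sons means that cardinality plus two falls at most by
half in each step. -/
lemma SplitsLongestEdges.card_root_add_two_le (hT : T.SplitsLongestEdges) :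
    ∀ {j : ℕ} {v : Finset (EuclideanSpace ℝ (Fin d))}, v ∈ T.level j →
      T.root.card + 2 ≤ 2 ^ j * (v.card + 2) := by
  induction T with
  | leaf u =>
    intro j v hv
    cases j with
    | zero => rw [Multiset.mem_singleton.1 hv]; simp [root]
    | succ j => simp [level] at hv
  | node u t₁ t₂ ih₁ ih₂ =>
    intro j v hv
    cases j with
    | zero => rw [Multiset.mem_singleton.1 hv]; simp [root]
    | succ j =>
      have h0 := hT.1.card_add
      have h1 := hT.1.card₁
      have h2 := hT.1.card₂
      simp only [root]
      rw [pow_succ]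
      rcases Multiset.mem_add.1 hv with h | h
      · have := ih₁ hT.2.1 h; lia
      · have := ih₂ hT.2.2 h; lia

/-- Dually, cardinality minus two falls at least by half; the form avoids subtraction. -/
lemma SplitsLongestEdges.card_le (hT : T.SplitsLongestEdges) :
    ∀ {j : ℕ} {v : Finset (EuclideanSpace ℝ (Fin d))}, v ∈ T.level j →
      2 ^ j * v.card + 2 ≤ T.root.card + 2 ^ j * 2 := by
  induction T with
  | leaf u =>
    intro j v hv
    cases j with
    | zero => rw [Multiset.mem_singleton.1 hv]; simp [root]
    | succ j => simp [level] at hv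
  | node u t₁ t₂ ih₁ ih₂ =>
    intro j v hv
    cases j with
    | zero => rw [Multiset.mem_singleton.1 hv]; simp [root]
    | succ j =>
      have h0 := hT.1.card_add
      have h1 := hT.1.card₁
      have h2 := hT.1.card₂
      simp only [root]
      rw [pow_succ]
      rcases Multiset.mem_add.1 hv with h | h
      · have := ih₁ hT.2.1 h; lia
      · have := ih₂ hT.2.2 h; lia

/-- Cardinality minus two at least doubles towards the root, which gives nothing when it starts from
two points. The nonempty sibling raises the first parent to three points, so the growth starts one
level later. -/
lemma SplitsLongestEdges.two_pow_add_four_le (hT : T.SplitsLongestEdges) :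
    ∀ {j : ℕ} {v : Finset (EuclideanSpace ℝ (Fin d))}, v ∈ T.level j → 1 < v.card →
      2 ≤ T.root.card ∧ (1 ≤ j → 2 ^ j + 4 ≤ 2 * T.root.card) := by
  induction T with
  | leaf u =>
    intro j v hv hc
    cases j with
    | zero => rw [Multiset.mem_singleton.1 hv] at hc; exact ⟨hc, fun h => absurd h (by omega)⟩
    | succ j => simp [level] at hv
  | node u t₁ t₂ ih₁ ih₂ =>
    intro j v hv hc
    cases j with
    | zero => rw [Multiset.mem_singleton.1 hv] at hc; exact ⟨hc, fun h => absurd h (by omega)⟩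
    | succ j =>
      have h0 := hT.1.card_add
      have h1 := hT.1.card₁
      have h2 := hT.1.card₂
      have h3 := hT.1.nonempty₁.card_pos
      have h4 := hT.1.nonempty₂.card_pos
      simp only [root]
      have key : ∀ n : ℕ, 2 ≤ n → (1 ≤ j → 2 ^ j + 4 ≤ 2 * n) → n + 1 ≤ u.card →
          2 * n ≤ u.card + 2 → 2 ≤ u.card ∧ (1 ≤ j + 1 → 2 ^ (j + 1) + 4 ≤ 2 * u.card) := by
        intro n hn hj ha hb
        refine ⟨by omega, fun _ => ?_⟩
        rcases Nat.eq_zero_or_pos j with rfl | hjpos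
        · norm_num; omega
        · have := hj hjpos
          rw [pow_succ]; omega
      rcases Multiset.mem_add.1 hv with h | h
      · have := ih₁ hT.2.1 h hc
        exact key _ this.1 this.2 (by omega) (by omega)
      · have := ih₂ hT.2.2 h hc
        exact key _ this.1 this.2 (by omega) (by omega)

lemma SplitsLongestEdges.two_pow_le (hT : T.SplitsLongestEdges) {j : ℕ}
    {v : Finset (EuclideanSpace ℝ (Fin d))} (hv : v ∈ T.level j) (hc : 1 < v.card) :
    2 ^ j ≤ 2 * T.root.card := by
  have h := hT.two_pow_add_four_le hv hc
  rcases Nat.eq_zero_or_pos j with rfl | hj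
  · norm_num; omega
  · have := h.2 hj; omega

end ClusterTree

/-! ### Volume comparison and the lower bound -/

section Packing
variable {d : ℕ}
open MeasureTheory

lemma volume_closedBall_eq (x : EuclideanSpace ℝ (Fin d)) {r : ℝ} (hr : 0 ≤ r) :
    volume (Metric.closedBall x r) =
      ENNReal.ofReal (r ^ d) * volume (Metric.ball (0 : EuclideanSpace ℝ (Fin d)) 1) := by
  rw [Measure.addHaar_closedBall _ _ hr, finrank_euclideanSpace_fin]

lemma volume_unitBall_pos : 0 < volume (Metric.ball (0 : EuclideanSpace ℝ (Fin d)) 1) :=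
  Metric.measure_ball_pos volume (0 : EuclideanSpace ℝ (Fin d)) one_pos

/-- Disjoint balls of radius `q` around the points of `s` fill part of the volume of `A`. -/
lemma card_mul_pow_mul_volume_le {s : Finset (EuclideanSpace ℝ (Fin d))} {q : ℝ} (hq : 0 ≤ q)
    (hsep : ∀ x ∈ s, ∀ y ∈ s, x ≠ y → 2 * q ≤ dist x y) {A : Set (EuclideanSpace ℝ (Fin d))}
    (hA : ∀ x ∈ s, Metric.closedBall x q ⊆ A) (hd : 1 ≤ d) :
    ENNReal.ofReal (s.card * q ^ d) * volume (Metric.ball (0 : EuclideanSpace ℝ (Fin d)) 1) ≤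
      volume A := by
  rcases hq.eq_or_lt with rfl | hq
  · simp [show d ≠ 0 by omega]
  have hball : ∀ x : EuclideanSpace ℝ (Fin d), volume (Metric.ball x q) =
      ENNReal.ofReal (q ^ d) * volume (Metric.ball (0 : EuclideanSpace ℝ (Fin d)) 1) := by
    intro x
    rw [Measure.addHaar_ball_of_pos _ _ hq, finrank_euclideanSpace_fin]
  calc _ = ∑ x ∈ s, volume (Metric.ball x q) := by
        simp only [hball, Finset.sum_const, nsmul_eq_mul]
        rw [ENNReal.ofReal_mul (by positivity), ENNReal.ofReal_natCast, mul_assoc]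
    _ = volume (⋃ x ∈ s, Metric.ball x q) := by
        rw [measure_biUnion_finset]
        · intro x hx y hy hxy
          exact Metric.ball_disjoint_ball (by have := hsep x hx y hy hxy; linarith)
        · exact fun x _ => measurableSet_ball
    _ ≤ volume A := measure_mono (Set.iUnion₂_subset fun x hx =>
        Metric.ball_subset_closedBall.trans (hA x hx))

lemma card_mul_pow_le_of_subset_closedBall (hd : 1 ≤ d)
    {s : Finset (EuclideanSpace ℝ (Fin d))} {q R : ℝ} (hq : 0 ≤ q) (hR : 0 ≤ R)
    (hsep : ∀ x ∈ s, ∀ y ∈ s, x ≠ y → 2 * q ≤ dist x y) {z : EuclideanSpace ℝ (Fin d)}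
    (hz : ∀ x ∈ s, dist x z ≤ R) : s.card * q ^ d ≤ (R + q) ^ d := by
  have h := card_mul_pow_mul_volume_le hq hsep (A := Metric.closedBall z (R + q))
    (fun x hx => Metric.closedBall_subset_closedBall' (by have := hz x hx; linarith)) hd
  rw [volume_closedBall_eq _ (by positivity)] at h
  rw [ENNReal.mul_le_mul_iff_left volume_unitBall_pos.ne' measure_ball_lt_top.ne] at h
  exact (ENNReal.ofReal_le_ofReal_iff (by positivity)).1 h

lemma pow_le_card_mul_pow_of_cover {v : Finset (EuclideanSpace ℝ (Fin d))} {h R : ℝ}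
    (hh : 0 ≤ h) (hR : 0 ≤ R) {p : EuclideanSpace ℝ (Fin d)}
    (hcov : ∀ y, dist y p ≤ R → ∃ x ∈ v, dist y x ≤ h) : R ^ d ≤ v.card * h ^ d := by
  have h1 : volume (Metric.closedBall p R) ≤ ∑ x ∈ v, volume (Metric.closedBall x h) := by
    refine (measure_mono fun y hy => ?_).trans (measure_biUnion_finset_le v _)
    obtain ⟨x, hx, hxy⟩ := hcov y hy
    exact Set.mem_biUnion hx hxy
  simp only [volume_closedBall_eq _ hR, volume_closedBall_eq _ hh, Finset.sum_const,
    nsmul_eq_mul] at h1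
  rw [← mul_assoc, ENNReal.mul_le_mul_iff_left volume_unitBall_pos.ne' measure_ball_lt_top.ne,
    ← ENNReal.ofReal_natCast, ← ENNReal.ofReal_mul (by positivity)] at h1
  exact (ENNReal.ofReal_le_ofReal_iff (by positivity)).1 h1

lemma sepRadius_nonneg (X : Finset (EuclideanSpace ℝ (Fin d))) : 0 ≤ sepRadius X :=
  mul_nonneg (by norm_num) Set.infsep_nonneg

lemma two_mul_sepRadius_le_dist {X : Finset (EuclideanSpace ℝ (Fin d))}
    {x y : EuclideanSpace ℝ (Fin d)} (hx : x ∈ X) (hy : y ∈ X) (hxy : x ≠ y) :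
    2 * sepRadius X ≤ dist x y := by
  have := Set.infsep_le_dist_of_mem (s := (X : Set (EuclideanSpace ℝ (Fin d)))) hx hy hxy
  unfold sepRadius
  linarith

lemma ClusterTree.SplitsLongestEdges.le_diam {T : ClusterTree d} (hd : 1 ≤ d)
    (hT : T.SplitsLongestEdges) {j : ℕ} {v : Finset (EuclideanSpace ℝ (Fin d))}
    (hv : v ∈ T.level j) (hc : 1 < v.card) :
    1 / 3 * (T.root.card : ℝ) ^ (1 / (d : ℝ)) * sepRadius T.root *
      (2 : ℝ) ^ (-((j : ℝ) / (d : ℝ))) ≤ Metric.diam (v : Set (EuclideanSpace ℝ (Fin d))) := by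
  have hdpos : (0 : ℝ) < d := by exact_mod_cast hd
  have hdne : d ≠ 0 := by omega
  set q := sepRadius T.root
  have hq : 0 ≤ q := sepRadius_nonneg _
  set D := Metric.diam (v : Set (EuclideanSpace ℝ (Fin d)))
  have hD : 0 ≤ D := Metric.diam_nonneg
  have hsub := hT.subset_root hv
  have hsep : ∀ x ∈ v, ∀ y ∈ v, x ≠ y → 2 * q ≤ dist x y := fun x hx y hy hxy =>
    two_mul_sepRadius_le_dist (hsub hx) (hsub hy) hxy
  have hb := v.finite_toSet.isBounded
  obtain ⟨z, hz, z', hz', hzz⟩ := Finset.one_lt_card.1 hc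
  have hqD : 2 * q ≤ D := (hsep z hz z' hz' hzz).trans (Metric.dist_le_diam_of_mem hb hz hz')
  have hpack := card_mul_pow_le_of_subset_closedBall hd hq hD hsep (z := z)
    fun x hx => Metric.dist_le_diam_of_mem hb hx hz
  have hcard : (T.root.card : ℝ) ≤ 2 ^ j * (2 * v.card) := by
    have h1 := hT.card_root_add_two_le hv
    have : T.root.card ≤ 2 ^ j * (2 * v.card) :=
      le_trans (by omega) (h1.trans (Nat.mul_le_mul_left _ (by omega)))
    exact_mod_cast this
  have e1 : ((T.root.card : ℝ) ^ (1 / (d : ℝ))) ^ d = T.root.card := by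
    rw [one_div]; exact Real.rpow_inv_natCast_pow (by positivity) hdne
  have e2 : ((2 : ℝ) ^ (-((j : ℝ) / (d : ℝ)))) ^ d = (2 ^ j)⁻¹ := by
    rw [← Real.rpow_natCast, ← Real.rpow_mul (by norm_num), neg_mul, div_mul_cancel₀ _ hdpos.ne',
      Real.rpow_neg (by norm_num), Real.rpow_natCast]
  refine le_of_pow_le_pow_left₀ hdne hD ?_
  rw [mul_pow, mul_pow, mul_pow, e1, e2]
  -- The factor two from the cardinalities is absorbed into `2^d`; then `q ≤ D/2` gives `(2/3)(D +
  -- q) ≤ D`, which is why `1/3` suffices.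
  have h2d : (2 : ℝ) ≤ 2 ^ d := le_self_pow₀ (by norm_num) hdne
  calc (1 / 3 : ℝ) ^ d * T.root.card * q ^ d * (2 ^ j)⁻¹
      ≤ (1 / 3 : ℝ) ^ d * (2 ^ j * (2 * v.card)) * q ^ d * (2 ^ j)⁻¹ := by gcongr
    _ = 2 * ((1 / 3 : ℝ) ^ d * (v.card * q ^ d)) := by field_simp
    _ ≤ 2 ^ d * ((1 / 3 : ℝ) ^ d * (D + q) ^ d) := by gcongr
    _ = (2 / 3 * (D + q)) ^ d := by rw [← mul_assoc, ← mul_pow, ← mul_pow]; norm_num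
    _ ≤ D ^ d := by
        apply pow_le_pow_left₀ (by positivity)
        linarith

end Packing
end

noncomputable section

/-! ### Shrinking convex sets into cells -/

section Cells
variable {d : ℕ}

/-- `K` is cut out of `K₀` by bounds for the coordinates outside of `Y`. -/
structure CoordCut (Y : Finset (Fin d)) (K₀ K : Set (EuclideanSpace ℝ (Fin d))) : Prop where
  subset : K ⊆ K₀
  mem_of_between : ∀ x ∈ K₀, (∀ i ∉ Y, ∃ a ∈ K, ∃ b ∈ K, a i ≤ x i ∧ x i ≤ b i) → x ∈ K

lemma CoordCut.refl (Y : Finset (Fin d)) (K : Set (EuclideanSpace ℝ (Fin d))) :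
    CoordCut Y K K :=
  ⟨subset_rfl, fun _ hx _ => hx⟩

lemma CoordCut.inter {Y : Finset (Fin d)} {K₀ K : Set (EuclideanSpace ℝ (Fin d))}
    (h : CoordCut Y K₀ K) {i : Fin d} (hi : i ∉ Y) {J : Set ℝ} (hJ : J.OrdConnected) :
    CoordCut Y K₀ (K ∩ {x | x i ∈ J}) := by
  refine ⟨Set.inter_subset_left.trans h.subset, fun x hx hb => ⟨h.mem_of_between x hx ?_, ?_⟩⟩
  · intro k hk
    obtain ⟨a, ha, b, hb, hab⟩ := hb k hk
    exact ⟨a, ha.1, b, hb.1, hab⟩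
  · obtain ⟨a, ha, b, hb, hab⟩ := hb i hi
    exact hJ.out ha.2 hb.2 hab

/-- Average, over all directions, the midpoints of two points extremal in that direction. In
direction `k` the `k`-th midpoint alone keeps the average at a distance of width over `2d` from both
extremes. -/
lemma exists_central_point (hd : 1 ≤ d) {K : Set (EuclideanSpace ℝ (Fin d))} (hK : IsCompact K)
    (hconv : Convex ℝ K) (hne : K.Nonempty) :
    ∃ p ∈ K, ∀ k, ∀ t : ℝ, |t - p k| ≤ coordWidth K k / (2 * d) →
      ∃ a ∈ K, ∃ b ∈ K, a k ≤ t ∧ t ≤ b k := by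
  have hdpos : (0 : ℝ) < d := by exact_mod_cast hd
  choose x hx y hy hxy hw using exists_sub_eq_coordWidth hK hne
  set z : Fin d → EuclideanSpace ℝ (Fin d) := fun i => (1 / 2 : ℝ) • x i + (1 / 2 : ℝ) • y i
  have hz : ∀ i, z i ∈ K := fun i =>
    hconv (hx i) (hy i) (by norm_num) (by norm_num) (by norm_num)
  have hzk : ∀ i k, z i k = (x i k + y i k) / 2 := by
    intro i k; simp [z]; ring
  set p : EuclideanSpace ℝ (Fin d) := ∑ i, (1 / (d : ℝ)) • z i
  have hp : p ∈ K := hconv.sum_mem (fun i _ => by positivity)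
    (by simp [hdpos.ne']) (fun i _ => hz i)
  have hpk : ∀ k, p k = ∑ i, (1 / (d : ℝ)) * z i k := by
    intro k; simp [p]
  refine ⟨p, hp, fun k t ht => ⟨y k, hy k, x k, hx k, ?_⟩⟩
  have hw' := hw k
  have hsum : ∀ c : ℝ, ∑ _i : Fin d, (1 / (d : ℝ)) * c = c := by
    intro c; simp; field_simp
  have hlow : (1 / (d : ℝ)) * (z k k - y k k) ≤ p k - y k k := by
    conv_rhs => rw [hpk, ← hsum (y k k), ← Finset.sum_sub_distrib]
    simp only [← mul_sub]
    exact Finset.single_le_sum (f := fun i => 1 / (d : ℝ) * (z i k - y k k))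
      (fun i _ => mul_nonneg (by positivity) (by linarith [(hxy k (z i) (hz i)).1]))
      (Finset.mem_univ k)
  have hupp : (1 / (d : ℝ)) * (x k k - z k k) ≤ x k k - p k := by
    conv_rhs => rw [hpk, ← hsum (x k k), ← Finset.sum_sub_distrib]
    simp only [← mul_sub]
    exact Finset.single_le_sum (f := fun i => 1 / (d : ℝ) * (x k k - z i k))
      (fun i _ => mul_nonneg (by positivity) (by linarith [(hxy k (z i) (hz i)).2]))
      (Finset.mem_univ k)
  have e1 : (1 / (d : ℝ)) * (z k k - y k k) = coordWidth K k / (2 * d) := by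
    rw [hzk, ← hw']; field_simp; ring
  have e2 : (1 / (d : ℝ)) * (x k k - z k k) = coordWidth K k / (2 * d) := by
    rw [hzk, ← hw']; field_simp; ring
  rw [e1] at hlow
  rw [e2] at hupp
  have := abs_le.1 ht
  constructor <;> linarith

lemma convex_combo_apply (p x : EuclideanSpace ℝ (Fin d)) (t : ℝ) (k : Fin d) :
    ((1 - t) • p + t • x) k - p k = t * (x k - p k) := by
  simp; ring

/-- A copy of `K₀` shrunk towards a central point of `K` moves the coordinates outside `Y` too
little to violate the cuts, and there are no cuts in the directions of `Y`. So `K` inherits a fixed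
proportion of the width of `K₀` in direction `y`. -/
lemma CoordCut.le_coordWidth (hd : 1 ≤ d) {Y : Finset (Fin d)}
    {K₀ K : Set (EuclideanSpace ℝ (Fin d))} (h : CoordCut Y K₀ K) (hK₀ : IsCompact K₀)
    (hconv₀ : Convex ℝ K₀) (hK : IsCompact K) (hconv : Convex ℝ K) (hne : K.Nonempty)
    {y : Fin d} {c μ : ℝ} (hc : ∀ k, c * coordWidth K₀ k ≤ coordWidth K₀ y)
    (hμ0 : 0 < μ) (hμ : ∀ i ∉ Y, μ ≤ coordWidth K i) (hμ' : ∃ k, μ ≤ coordWidth K k) :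
    c / (2 * d) * μ ≤ coordWidth K y := by
  have hdpos : (0 : ℝ) < d := by exact_mod_cast hd
  have hd1 : (1 : ℝ) ≤ d := by exact_mod_cast hd
  have : Nonempty (Fin d) := ⟨y⟩
  obtain ⟨m, hm⟩ := Finite.exists_max fun k => coordWidth K₀ k
  obtain ⟨k', hk'⟩ := hμ'
  obtain ⟨p, hp, hcen⟩ := exists_central_point hd hK hconv hne
  set ℓ := coordWidth K₀ m
  have hμℓ : μ ≤ ℓ := hk'.trans ((coordWidth_mono hK₀.isBounded hne h.subset).trans (hm k'))
  have hℓ : 0 < ℓ := hμ0.trans_le hμℓ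
  -- The ratio for which the largest width of `K₀` shrinks to `μ / (2d)`, the room around the
  -- central point.
  set t : ℝ := μ / (2 * d * ℓ)
  have ht0 : 0 ≤ t := by positivity
  have ht1 : t ≤ 1 := by
    rw [div_le_one (by positivity)]
    nlinarith
  have htℓ : t * ℓ = μ / (2 * d) := by simp only [t]; field_simp
  have hmem : ∀ x ∈ K₀, (1 - t) • p + t • x ∈ K := by
    intro x hx
    refine h.mem_of_between _
      (hconv₀ (h.subset hp) hx (by linarith) ht0 (by ring)) fun i hi => ?_
    refine hcen i _ ?_
    rw [convex_combo_apply, abs_mul, abs_of_nonneg ht0]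
    have h1 := (abs_sub_le_coordWidth (i := i) hK₀.isBounded hx (h.subset hp)).trans (hm i)
    calc t * |x i - p i| ≤ t * ℓ := by gcongr
      _ = μ / (2 * d) := htℓ
      _ ≤ coordWidth K i / (2 * d) := by have := hμ i hi; gcongr
  obtain ⟨x, hx, x', hx', -, hw⟩ := exists_sub_eq_coordWidth hK₀ (hne.mono h.subset) y
  have h1 := sub_le_coordWidth (i := y) hK.isBounded (hmem x hx) (hmem x' hx')
  have h2 := convex_combo_apply p x t y
  have h3 := convex_combo_apply p x' t y
  have h4 : ((1 - t) • p + t • x) y - ((1 - t) • p + t • x') y = t * coordWidth K₀ y := by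
    rw [← hw]; linarith
  rw [h4] at h1
  refine le_trans ?_ h1
  calc c / (2 * d) * μ = t * (c * ℓ) := by rw [mul_left_comm, htℓ]; ring
    _ ≤ t * coordWidth K₀ y := by have := hc m; gcongr

/-- The same shrinking with no free direction: the inner ball of `Ω` is carried into `K`. -/
lemma CoordCut.exists_closedBall_subset (hd : 1 ≤ d) {Ω K : Set (EuclideanSpace ℝ (Fin d))}
    (h : CoordCut ∅ Ω K) (hconvΩ : Convex ℝ Ω) (hK : IsCompact K) (hconv : Convex ℝ K)
    (hne : K.Nonempty) {z : EuclideanSpace ℝ (Fin d)} {r D : ℝ}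
    (hball : Metric.closedBall z r ⊆ Ω) (hD : 0 < D) (hdiam : ∀ x ∈ Ω, ∀ y ∈ Ω, dist x y ≤ D)
    {e : ℝ} (he0 : 0 < e) (he : ∀ k, e ≤ coordWidth K k) :
    ∃ p, Metric.closedBall p (e / (2 * d * D) * r) ⊆ K := by
  have hdpos : (0 : ℝ) < d := by exact_mod_cast hd
  have hd1 : (1 : ℝ) ≤ d := by exact_mod_cast hd
  obtain ⟨p, hp, hcen⟩ := exists_central_point hd hK hconv hne
  set t : ℝ := e / (2 * d * D)
  have ht : 0 < t := by positivity
  have heD : e ≤ D := by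
    refine (he ⟨0, hd⟩).trans ?_
    obtain ⟨x, hx, x', hx', -, hw⟩ := exists_sub_eq_coordWidth hK hne ⟨0, hd⟩
    rw [← hw]
    exact (le_abs_self _).trans ((abs_coord_sub_le_dist x x' _).trans
      (hdiam x (h.subset hx) x' (h.subset hx')))
  have ht1 : t ≤ 1 := by
    rw [div_le_one (by positivity)]
    nlinarith
  refine ⟨(1 - t) • p + t • z, fun u hu => ?_⟩
  set x := z + t⁻¹ • (u - ((1 - t) • p + t • z))
  have hx : x ∈ Ω := by
    apply hball
    rw [Metric.mem_closedBall, dist_eq_norm] at hu ⊢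
    have : x - z = t⁻¹ • (u - ((1 - t) • p + t • z)) := by simp [x]
    rw [this, norm_smul, norm_inv, Real.norm_of_nonneg ht.le, inv_mul_le_iff₀ ht]
    exact hu
  have hux : u = (1 - t) • p + t • x := by
    simp only [x, smul_add, smul_inv_smul₀ ht.ne']
    abel
  rw [hux]
  refine h.mem_of_between _
    (hconvΩ (h.subset hp) hx (by linarith) ht.le (by ring)) fun i _ => hcen i _ ?_
  rw [convex_combo_apply, abs_mul, abs_of_nonneg ht.le]
  calc t * |x i - p i| ≤ t * D := by
        have := (abs_coord_sub_le_dist x p i).trans (hdiam x hx p (h.subset hp)); gcongr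
    _ = e / (2 * d) := by simp only [t]; field_simp
    _ ≤ coordWidth K i / (2 * d) := by have := he i; gcongr

/-- Apply the hypothesis to the set of directions not yet known to be wide. Each round adds a
direction at the cost of a factor `κ`, so `d` rounds suffice. -/
lemma pow_mul_le_of_forall_finset {a : Fin d → ℝ} {κ M : ℝ} (hκ0 : 0 ≤ κ) (hκ1 : κ ≤ 1)
    (hM : 0 ≤ M) (h : ∀ Y : Finset (Fin d), Y.Nonempty → ∀ n : ℕ,
      (∀ i ∉ Y, κ ^ n * M ≤ a i) → ∃ y ∈ Y, κ ^ (n + 1) * M ≤ a y) (i : Fin d) :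
    κ ^ d * M ≤ a i := by
  classical
  have key : ∀ n : ℕ, n ≤ d → n ≤ (Finset.univ.filter fun i => κ ^ n * M ≤ a i).card := by
    intro n
    induction n with
    | zero => simp
    | succ n ih =>
      intro hn
      have ih' := ih (by omega)
      set S := Finset.univ.filter fun i => κ ^ n * M ≤ a i with hS
      have hsub : S ⊆ Finset.univ.filter fun i => κ ^ (n + 1) * M ≤ a i := by
        intro i hi
        rw [hS, Finset.mem_filter] at hi
        rw [Finset.mem_filter]
        refine ⟨hi.1, le_trans ?_ hi.2⟩
        rw [pow_succ]
        have : κ ^ n * κ ≤ κ ^ n := mul_le_of_le_one_right (by positivity) hκ1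
        gcongr
      rcases Sᶜ.eq_empty_or_nonempty with h0 | h0
      · rw [Finset.compl_eq_empty_iff] at h0
        have := Finset.card_le_card hsub
        rw [h0, Finset.card_univ, Fintype.card_fin] at this
        omega
      · obtain ⟨y, hy, hya⟩ := h Sᶜ h0 n fun i hi => by
          rw [Finset.mem_compl, not_not, hS, Finset.mem_filter] at hi
          exact hi.2
        have hlt : S.card < (Finset.univ.filter fun i => κ ^ (n + 1) * M ≤ a i).card := by
          refine Finset.card_lt_card ⟨hsub, fun hc => ?_⟩
          rw [Finset.mem_compl] at hy
          exact hy (hc (by simp [hya]))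
        omega
  have hcard := key d le_rfl
  have : (Finset.univ.filter fun i => κ ^ d * M ≤ a i) = Finset.univ :=
    Finset.eq_univ_of_card _ (le_antisymm (Finset.card_le_univ _) (by simpa using hcard))
  have hi := Finset.mem_univ i
  rw [← this, Finset.mem_filter] at hi
  exact hi.2

lemma closedBall_half_subset {K : Set (EuclideanSpace ℝ (Fin d))} (hconv : Convex ℝ K)
    {p y : EuclideanSpace ℝ (Fin d)} {ρ : ℝ} (hball : Metric.closedBall p ρ ⊆ K) (hy : y ∈ K) :
    Metric.closedBall ((1 / 2 : ℝ) • p + (1 / 2 : ℝ) • y) (ρ / 2) ⊆ K := by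
  intro u hu
  have hp' : (2 : ℝ) • u - y ∈ K := by
    apply hball
    rw [Metric.mem_closedBall, dist_eq_norm] at hu ⊢
    have : (2 : ℝ) • u - y - p = (2 : ℝ) • (u - ((1 / 2 : ℝ) • p + (1 / 2 : ℝ) • y)) := by
      module
    rw [this, norm_smul, Real.norm_of_nonneg zero_le_two]
    linarith
  have : u = (1 / 2 : ℝ) • ((2 : ℝ) • u - y) + (1 / 2 : ℝ) • y := by module
  rw [this]
  exact hconv hp' hy (by norm_num) (by norm_num) (by norm_num)

end Cells
end

noncomputable section

/-! ### Many quasi-uniform points do not fit into a thin slab -/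

section Slab
variable {d : ℕ}

/-- If all points of a large part `s` of `v` lie in a slab of width `w`, then `w` is comparable to
the width of the convex set `K`: otherwise `K` has room for many shrunken copies of `s`, which all
have to be close to points of `v`. -/
lemma coordWidth_le_of_card_le (hd : 1 ≤ d) {K : Set (EuclideanSpace ℝ (Fin d))}
    (hK : IsCompact K) (hconv : Convex ℝ K) {p : EuclideanSpace ℝ (Fin d)} {ρ : ℝ}
    (hball : Metric.closedBall p ρ ⊆ K) {v s : Finset (EuclideanSpace ℝ (Fin d))} {h q a : ℝ}
    (hh : 0 < h) (ha : 1 ≤ a) (hqa : h ≤ a * q)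
    (hnear : ∀ x, Metric.closedBall x (ρ / 2) ⊆ K → ∃ y ∈ v, dist x y ≤ h)
    (hs : s.Nonempty) (hsK : (s : Set (EuclideanSpace ℝ (Fin d))) ⊆ K)
    (hsep : ∀ x ∈ s, ∀ y ∈ s, x ≠ y → 2 * q ≤ dist x y) (hcard : v.card ≤ 4 * s.card)
    {i : Fin d} {w : ℝ} (hw : ∀ x ∈ s, ∀ y ∈ s, |x i - y i| ≤ w) {P : ℕ}
    (hP : (4 * a + 1) ^ d ≤ P) : coordWidth K i ≤ 24 * P * (w + h) := by
  classical
  have ha0 : 0 < a := by linarith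
  have hP1 : (1 : ℝ) ≤ P := le_trans (one_le_pow₀ (by linarith)) hP
  obtain ⟨x₀, hx₀⟩ := hs
  have hw0 : 0 ≤ w := (abs_nonneg _).trans (hw x₀ hx₀ x₀ hx₀)
  by_contra! hlt
  set ℓ := coordWidth K i with hℓ
  have hℓ24 : 24 * (w + h) ≤ ℓ := by nlinarith
  have hℓ0 : 0 < ℓ := by linarith
  -- One of the two extremal points of `K` in direction `i` is at least half the width away from the
  -- slab, up to its thickness.
  obtain ⟨z, hz, hzfar⟩ : ∃ z ∈ K, ∀ x ∈ s, ℓ / 3 ≤ |x i - z i| := by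
    obtain ⟨x, hx, y, hy, -, hxy⟩ := exists_sub_eq_coordWidth hK ⟨x₀, hsK hx₀⟩ i
    rw [← hℓ] at hxy
    have hone : ℓ / 2 ≤ |x₀ i - x i| ∨ ℓ / 2 ≤ |x₀ i - y i| := by
      by_contra! hc
      have h1 := abs_lt.1 hc.1
      have h2 := abs_lt.1 hc.2
      linarith
    have hfar : ∀ z, ℓ / 2 ≤ |x₀ i - z| → ∀ x' ∈ s, ℓ / 3 ≤ |x' i - z| := by
      intro z hz x' hx'
      have h1 := hw x₀ hx₀ x' hx'
      have h2 := abs_sub_le (x₀ i) (x' i) z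
      linarith
    rcases hone with h1 | h1
    · exact ⟨x, hx, hfar _ h1⟩
    · exact ⟨y, hy, hfar _ h1⟩
  set n := 4 * P + 1
  -- Contracting towards `z` by one more `β` shifts the slab by at least `w + h`, so different
  -- copies are `h` apart; all `4P + 1` ratios stay above `1/2`.
  set β : ℝ := 3 * (w + h) / ℓ
  have hβ0 : 0 ≤ β := by positivity
  have hβℓ : β * (ℓ / 3) = w + h := by simp only [β]; field_simp
  have hβn : β * (4 * P) ≤ 1 / 2 := by
    simp only [β]
    rw [div_mul_eq_mul_div, div_le_iff₀ hℓ0]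
    linarith
  have hlam : ∀ k ∈ Finset.range n, (1 : ℝ) / 2 ≤ 1 - k * β ∧ 1 - k * β ≤ 1 := by
    intro k hk
    have hk' : (k : ℝ) ≤ 4 * P := by
      have := Finset.mem_range.1 hk
      exact_mod_cast (by omega : k ≤ 4 * P)
    have : k * β ≤ 1 / 2 := by nlinarith
    have : 0 ≤ k * β := by positivity
    constructor <;> linarith
  -- The further halving towards `p` leaves a ball of radius `ρ/2` inside `K` around each image, so
  -- that each image has a point of `v` nearby.
  set g : ℕ × EuclideanSpace ℝ (Fin d) → EuclideanSpace ℝ (Fin d) := fun b =>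
    (1 / 2 : ℝ) • p + (1 / 2 : ℝ) • (z + (1 - b.1 * β) • (b.2 - z)) with hg
  set S := Finset.range n ×ˢ s with hS
  set δ := h / a
  have hδ0 : 0 < δ := by positivity
  have hδq : δ ≤ q := by rw [div_le_iff₀ ha0]; linarith
  have hδh : δ ≤ h := div_le_self hh.le ha
  have hgsep : ∀ b ∈ S, ∀ b' ∈ S, b ≠ b' → 2 * (δ / 4) ≤ dist (g b) (g b') := by
    rintro ⟨k, x⟩ hb ⟨k', x'⟩ hb' hne
    simp only [hS, Finset.mem_product] at hb hb'
    have hl := hlam k hb.1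
    have hl' := hlam k' hb'.1
    have hmain : δ ≤ ‖(1 - k * β) • (x - z) - (1 - k' * β) • (x' - z)‖ := by
      rcases eq_or_ne k k' with rfl | hk
      · have hxx : x ≠ x' := fun hc => hne (by rw [hc])
        rw [← smul_sub, sub_sub_sub_cancel_right, norm_smul, Real.norm_of_nonneg (by linarith),
          ← dist_eq_norm]
        have := hsep x hb.2 x' hb'.2 hxx
        nlinarith
      · refine hδh.trans (le_trans ?_ (PiLp.norm_apply_le _ i))
        have e : ((1 - k * β) • (x - z) - (1 - k' * β) • (x' - z)) i =
            (1 - k' * β) * (x i - x' i) - (((k : ℝ) - k') * β) * (x i - z i) := by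
          simp; ring
        rw [e, Real.norm_eq_abs, abs_sub_comm]
        refine le_trans ?_ (abs_sub_abs_le_abs_sub _ _)
        rw [abs_mul, abs_mul, abs_mul, abs_of_nonneg hβ0, abs_of_nonneg (by linarith : 0 ≤ 1 - k' * β)]
        have h1 : (1 : ℝ) ≤ |(k : ℝ) - k'| := by
          have : (1 : ℤ) ≤ |(k : ℤ) - k'| := Int.one_le_abs (by omega)
          exact_mod_cast this
        have h2 := hzfar x hb.2
        have h3 := hw x hb.2 x' hb'.2
        have h4 : w + h ≤ |(k : ℝ) - k'| * β * |x i - z i| := by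
          rw [← hβℓ]
          gcongr
          exact le_mul_of_one_le_left hβ0 h1
        have h5 : (1 - k' * β) * |x i - x' i| ≤ w :=
          (mul_le_of_le_one_left (abs_nonneg _) hl'.2).trans h3
        linarith
    rw [dist_eq_norm]
    have e : g (k, x) - g (k', x') =
        (1 / 2 : ℝ) • ((1 - k * β) • (x - z) - (1 - k' * β) • (x' - z)) := by
      simp only [hg]; module
    rw [e, norm_smul, Real.norm_of_nonneg (by norm_num)]
    linarith
  have hgnear : ∀ b ∈ S, ∃ y ∈ v, dist (g b) y ≤ h := by
    rintro ⟨k, x⟩ hb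
    simp only [hS, Finset.mem_product] at hb
    have hl := hlam k hb.1
    refine hnear _ (closedBall_half_subset hconv hball ?_)
    have e : z + (1 - (k : ℝ) * β) • (x - z) = (k * β) • z + (1 - k * β) • x := by module
    rw [e]
    exact hconv hz (hsK hb.2) (by linarith) (by linarith) (by ring)
  choose! f hfv hfd using hgnear
  -- The images are `δ/2`-separated, so at most `((h + δ/4) / (δ/4))^d = (4a + 1)^d` of them lie
  -- within `h` of `y`.
  have hfib : ∀ y ∈ v, (S.filter fun b => f b = y).card ≤ P := by
    intro y hy
    set A := S.filter fun b => f b = y with hA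
    have hAS : ∀ b ∈ A, b ∈ S ∧ f b = y := fun b hb => Finset.mem_filter.1 hb
    have hinj : Set.InjOn g A := by
      intro b hb b' hb' hbb
      by_contra hne
      have := hgsep b (hAS b hb).1 b' (hAS b' hb').1 hne
      rw [hbb, dist_self] at this
      linarith
    rw [← Finset.card_image_of_injOn hinj]
    have := card_mul_pow_le_of_subset_closedBall hd (s := A.image g) (q := δ / 4) (R := h)
      (by positivity) hh.le (z := y) ?_ ?_
    · have h1 : h + δ / 4 = (4 * a + 1) * (δ / 4) := by simp only [δ]; field_simp
      rw [h1, mul_pow] at this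
      have h2 := (le_of_mul_le_mul_right this (by positivity)).trans hP
      exact_mod_cast h2
    · intro u hu u' hu' hne
      obtain ⟨b, hb, rfl⟩ := Finset.mem_image.1 hu
      obtain ⟨b', hb', rfl⟩ := Finset.mem_image.1 hu'
      exact hgsep b (hAS b hb).1 b' (hAS b' hb').1 fun hc => hne (by rw [hc])
    · intro u hu
      obtain ⟨b, hb, rfl⟩ := Finset.mem_image.1 hu
      have := hfd b (hAS b hb).1
      rwa [(hAS b hb).2] at this
  -- Now `(4P + 1)|s| ≤ P|v| ≤ 4P|s|`, a contradiction.
  have hcount := Finset.card_le_mul_card_image_of_maps_to hfv P hfib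
  rw [hS, Finset.card_product, Finset.card_range] at hcount
  have hspos : 0 < s.card := Finset.card_pos.2 ⟨x₀, hx₀⟩
  have : P * v.card ≤ P * (4 * s.card) := Nat.mul_le_mul_left _ hcard
  have h3 : n * s.card = P * (4 * s.card) + s.card := by simp only [n]; ring
  omega

end Slab

/-! ### Cells of clusters and their aspect ratio -/

section ClusterCell
variable {d : ℕ}

/-- `K` is the part of `Ω` in the cell of a cluster `v ⊆ X`. For every set `Y` of directions, `K`
arises by cuts in the other directions from a set one of whose widths in the directions of `Y` is
comparable to its largest width. -/
structure ClusterCell (Ω : Set (EuclideanSpace ℝ (Fin d)))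
    (X : Finset (EuclideanSpace ℝ (Fin d))) (c : ℝ) (v : Finset (EuclideanSpace ℝ (Fin d)))
    (K : Set (EuclideanSpace ℝ (Fin d))) : Prop where
  isCompact : IsCompact K
  convex : Convex ℝ K
  nonempty : v.Nonempty
  subset : (v : Set (EuclideanSpace ℝ (Fin d))) ⊆ K
  subset_points : v ⊆ X
  cut : CoordCut ∅ Ω K
  outside : ∀ x ∈ X, x ∉ v → ∃ i, (∀ y ∈ K, x i ≤ y i) ∨ (∀ y ∈ K, y i ≤ x i)
  exists_wide : ∀ Y : Finset (Fin d), Y.Nonempty → ∃ K₀ : Set (EuclideanSpace ℝ (Fin d)),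
    IsCompact K₀ ∧ Convex ℝ K₀ ∧ CoordCut Y K₀ K ∧
      ∃ y ∈ Y, ∀ k, c * coordWidth K₀ k ≤ coordWidth K₀ y

variable {Ω K : Set (EuclideanSpace ℝ (Fin d))} {X v s : Finset (EuclideanSpace ℝ (Fin d))}
  {c : ℝ}

lemma ClusterCell.nonempty_cell (h : ClusterCell Ω X c v K) : K.Nonempty :=
  (Finset.coe_nonempty.2 h.nonempty).mono h.subset

lemma ClusterCell.root (hΩ : IsCompact Ω) (hconv : Convex ℝ Ω) (hX : X.Nonempty)
    (hXΩ : (X : Set (EuclideanSpace ℝ (Fin d))) ⊆ Ω)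
    (hc : ∀ k y, c * coordWidth Ω k ≤ coordWidth Ω y) : ClusterCell Ω X c X Ω where
  isCompact := hΩ
  convex := hconv
  nonempty := hX
  subset := hXΩ
  subset_points := subset_rfl
  cut := CoordCut.refl _ _
  outside := fun _ hx hx' => absurd hx hx'
  exists_wide := fun _ ⟨y, hy⟩ => ⟨Ω, hΩ, hconv, CoordCut.refl _ _, y, hy, fun k => hc k y⟩

lemma ClusterCell.child (h : ClusterCell Ω X c v K) (hc : 0 ≤ c) (hs : s.Nonempty) (hsv : s ⊆ v)
    {i : Fin d} {J : Set ℝ} (hJ : J.OrdConnected) (hJc : IsClosed J) (hsJ : ∀ x ∈ s, x i ∈ J)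
    (hout : ∀ x ∈ v, x ∉ s → (∀ t ∈ J, x i ≤ t) ∨ (∀ t ∈ J, t ≤ x i))
    (hw : ∀ k, c * coordWidth K k ≤ coordWidth (K ∩ {x | x i ∈ J}) i) :
    ClusterCell Ω X c s (K ∩ {x | x i ∈ J}) := by
  have hclosed : IsClosed {x : EuclideanSpace ℝ (Fin d) | x i ∈ J} :=
    hJc.preimage (lipschitzWith_coord i).continuous
  have hcJ : Convex ℝ {x : EuclideanSpace ℝ (Fin d) | x i ∈ J} :=
    hJ.convex.linear_preimage (EuclideanSpace.proj (𝕜 := ℝ) i).toLinearMap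
  have hsub : (s : Set (EuclideanSpace ℝ (Fin d))) ⊆ K ∩ {x | x i ∈ J} := fun x hx =>
    ⟨h.subset (hsv hx), hsJ x hx⟩
  have hK' : IsCompact (K ∩ {x | x i ∈ J}) := h.isCompact.inter_right hclosed
  refine ⟨hK', h.convex.inter hcJ, hs, hsub, hsv.trans h.subset_points,
    h.cut.inter (Finset.notMem_empty i) hJ, ?_, ?_⟩
  · intro x hx hxs
    by_cases hxv : x ∈ v
    · rcases hout x hxv hxs with h1 | h1
      · exact ⟨i, Or.inl fun y hy => h1 _ hy.2⟩
      · exact ⟨i, Or.inr fun y hy => h1 _ hy.2⟩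
    · obtain ⟨k, hk⟩ := h.outside x hx hxv
      exact ⟨k, hk.imp (fun h1 y hy => h1 y hy.1) fun h1 y hy => h1 y hy.1⟩
  · intro Y hY
    -- A cut in a direction of `Y` makes the new cell its own reference set; any other cut keeps the
    -- old one. The reference set is thus the cell after the last cut in `Y`.
    by_cases hi : i ∈ Y
    · refine ⟨_, hK', h.convex.inter hcJ, CoordCut.refl _ _, i, hi, fun k => ?_⟩
      refine le_trans ?_ (hw k)
      have := coordWidth_mono (i := k) h.isCompact.isBounded
        ((Finset.coe_nonempty.2 hs).mono hsub) Set.inter_subset_left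
      gcongr
    · obtain ⟨K₀, h1, h2, h3, h4⟩ := h.exists_wide Y hY
      exact ⟨K₀, h1, h2, h3.inter hi hJ, h4⟩

lemma ClusterCell.le_coordWidth (h : ClusterCell Ω X c v K) (hd : 1 ≤ d) (hc0 : 0 < c)
    (hc1 : c ≤ 1) {k₀ : Fin d} (hM : 0 < coordWidth K k₀) (k : Fin d) :
    (c / (2 * d)) ^ d * coordWidth K k₀ ≤ coordWidth K k := by
  have hd1 : (1 : ℝ) ≤ d := by exact_mod_cast hd
  have hκ0 : 0 < c / (2 * d) := by positivity
  have hκ1 : c / (2 * d) ≤ 1 := by rw [div_le_one (by positivity)]; linarith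
  refine pow_mul_le_of_forall_finset hκ0.le hκ1 hM.le (fun Y hY n hn => ?_) k
  obtain ⟨K₀, h1, h2, h3, y, hy, h4⟩ := h.exists_wide Y hY
  refine ⟨y, hy, ?_⟩
  rw [pow_succ', mul_assoc]
  exact h3.le_coordWidth hd h1 h2 h.isCompact h.convex h.nonempty_cell h4 (by positivity) hn
    ⟨k₀, mul_le_of_le_one_left hM.le (pow_le_one₀ hκ0.le hκ1)⟩

/-- A point of `X` outside `v` lies weakly beyond a face of the cell, so it cannot be an interior
point of `K`. The inequality `η < R` must be strict because points on a cutting hyperplane may go to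
either side. -/
lemma ClusterCell.exists_near (h : ClusterCell Ω X c v K) {η R : ℝ}
    (hη : 0 ≤ η) (hfill : ∀ x ∈ Ω, ∃ y ∈ X, dist x y ≤ η) (hR : η < R) {x : EuclideanSpace ℝ (Fin d)}
    (hball : Metric.closedBall x R ⊆ K) : ∃ y ∈ v, dist x y ≤ η := by
  have hx : x ∈ Ω := h.cut.subset (hball (Metric.mem_closedBall_self (hη.trans hR.le)))
  obtain ⟨y, hy, hxy⟩ := hfill x hx
  refine ⟨y, ?_, hxy⟩
  by_contra hyv
  obtain ⟨i, hi⟩ := h.outside y hy hyv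
  have hmem : ∀ ε : ℝ, |ε| ≤ R - η → y + EuclideanSpace.single i ε ∈ K := by
    intro ε hε
    apply hball
    rw [Metric.mem_closedBall]
    calc dist (y + EuclideanSpace.single i ε) x
        ≤ dist (y + EuclideanSpace.single i ε) y + dist y x := dist_triangle _ _ _
      _ ≤ (R - η) + η := by
          refine add_le_add ?_ (by rwa [dist_comm])
          rw [dist_eq_norm, add_sub_cancel_left, PiLp.norm_single]
          exact hε
      _ = R := by ring
  have hpos : 0 < R - η := by linarith
  rcases hi with hi | hi
  · have := hi _ (hmem (-(R - η)) (by rw [abs_neg, abs_of_pos hpos]))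
    simp at this
    linarith
  · have := hi _ (hmem (R - η) (by rw [abs_of_pos hpos]))
    simp at this
    linarith

end ClusterCell
end

noncomputable section

/-! ### Quasi-uniform points: large cells stay well shaped -/

section QuasiUniform
variable {d : ℕ}

/-- Points `X` in a convex set `Ω` with an inner ball of radius `r` and diameter at most `D`, with
separation `q` and fill distance at most `η ≤ a * q`, and constants `P`, `c`, `C` for which the
cells of a balanced tree have bounded aspect ratio as long as their width is at least `C * η`. -/
structure QuasiUniformIn (Ω : Set (EuclideanSpace ℝ (Fin d)))
    (X : Finset (EuclideanSpace ℝ (Fin d))) (z : EuclideanSpace ℝ (Fin d))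
    (r D η q a c C : ℝ) (P : ℕ) : Prop where
  isCompact : IsCompact Ω
  convex : Convex ℝ Ω
  subset : (X : Set (EuclideanSpace ℝ (Fin d))) ⊆ Ω
  r_pos : 0 < r
  ball : Metric.closedBall z r ⊆ Ω
  D_pos : 0 < D
  dist_le : ∀ x ∈ Ω, ∀ y ∈ Ω, dist x y ≤ D
  η_pos : 0 < η
  one_le_a : 1 ≤ a
  η_le : η ≤ a * q
  sep : ∀ x ∈ X, ∀ y ∈ X, x ≠ y → 2 * q ≤ dist x y
  fill : ∀ x ∈ Ω, ∃ y ∈ X, dist x y ≤ η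
  P_ge : (4 * a + 1) ^ d ≤ P
  c_pos : 0 < c
  c_mul_P_le : 192 * P * c ≤ 1
  c_mul_D_le : c * D ≤ r
  P_le_C : 192 * P ≤ C
  lt_C_mul : 2 < (c / (2 * d)) ^ d * C / (2 * d * D) * r

variable {Ω K : Set (EuclideanSpace ℝ (Fin d))} {X v s s₁ s₂ : Finset (EuclideanSpace ℝ (Fin d))}
  {z : EuclideanSpace ℝ (Fin d)} {r D η q a c C : ℝ} {P : ℕ}

lemma QuasiUniformIn.one_le_P (hQ : QuasiUniformIn Ω X z r D η q a c C P) : (1 : ℝ) ≤ P :=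
  (one_le_pow₀ (by linarith [hQ.one_le_a])).trans hQ.P_ge

lemma QuasiUniformIn.C_pos (hQ : QuasiUniformIn Ω X z r D η q a c C P) : 0 < C := by
  linarith [hQ.one_le_P, hQ.P_le_C]

lemma QuasiUniformIn.c_le_one (hQ : QuasiUniformIn Ω X z r D η q a c C P) : c ≤ 1 := by
  have := hQ.one_le_P
  have := hQ.c_mul_P_le
  have := hQ.c_pos
  nlinarith

lemma QuasiUniformIn.root (hQ : QuasiUniformIn Ω X z r D η q a c C P) (hX : X.Nonempty) :
    ClusterCell Ω X c X Ω := by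
  refine ClusterCell.root hQ.isCompact hQ.convex hX hQ.subset fun k y => ?_
  have hne : Ω.Nonempty := (Finset.coe_nonempty.2 hX).mono hQ.subset
  obtain ⟨x, hx, x', hx', -, h1⟩ := exists_sub_eq_coordWidth hQ.isCompact hne k
  have h2 : coordWidth Ω k ≤ D := by
    rw [← h1]
    exact (le_abs_self _).trans ((abs_coord_sub_le_dist x x' k).trans (hQ.dist_le x hx x' hx'))
  have hmem : z + EuclideanSpace.single y r ∈ Ω := by
    apply hQ.ball
    rw [Metric.mem_closedBall, dist_eq_norm, add_sub_cancel_left, PiLp.norm_single,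
      Real.norm_of_nonneg hQ.r_pos.le]
  have h3 := sub_le_coordWidth (i := y) hQ.isCompact.isBounded hmem
    (hQ.ball (Metric.mem_closedBall_self hQ.r_pos.le))
  simp at h3
  calc c * coordWidth Ω k ≤ c * D := mul_le_mul_of_nonneg_left h2 hQ.c_pos.le
    _ ≤ r := hQ.c_mul_D_le
    _ ≤ coordWidth Ω y := h3

lemma ClusterCell.exists_ball (hd : 1 ≤ d) (hQ : QuasiUniformIn Ω X z r D η q a c C P)
    (h : ClusterCell Ω X c v K) {k₀ : Fin d} (hM : C * η ≤ coordWidth K k₀) :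
    ∃ p, Metric.closedBall p ((c / (2 * d)) ^ d * coordWidth K k₀ / (2 * d * D) * r) ⊆ K ∧
      η < (c / (2 * d)) ^ d * coordWidth K k₀ / (2 * d * D) * r / 2 := by
  have hdpos : (0 : ℝ) < d := by exact_mod_cast hd
  have hCη : 0 < C * η := mul_pos hQ.C_pos hQ.η_pos
  have hMpos : 0 < coordWidth K k₀ := hCη.trans_le hM
  have := hQ.c_pos
  have := hQ.D_pos
  have := hQ.r_pos
  have hηpos := hQ.η_pos
  obtain ⟨p, hp⟩ := h.cut.exists_closedBall_subset hd hQ.convex h.isCompact h.convex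
    h.nonempty_cell hQ.ball hQ.D_pos hQ.dist_le
    (e := (c / (2 * d)) ^ d * coordWidth K k₀) (by positivity)
    fun k => h.le_coordWidth hd hQ.c_pos hQ.c_le_one hMpos k
  refine ⟨p, hp, ?_⟩
  have h1 : (c / (2 * d)) ^ d * (C * η) / (2 * d * D) * r ≤
      (c / (2 * d)) ^ d * coordWidth K k₀ / (2 * d * D) * r := by gcongr
  have h2 : (c / (2 * d)) ^ d * (C * η) / (2 * d * D) * r =
      ((c / (2 * d)) ^ d * C / (2 * d * D) * r) * η := by ring
  have h3 := hQ.lt_C_mul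
  rw [h2] at h1
  nlinarith

/-- Extremal points of the cell, moved halfway to `p`, lie within `η` of points of `v`. Hence a
longest edge of the bounding box is comparable to the largest width of the cell. -/
lemma ClusterCell.coordWidth_le_boxEdge (hQ : QuasiUniformIn Ω X z r D η q a c C P)
    (h : ClusterCell Ω X c v K) {p : EuclideanSpace ℝ (Fin d)} {ρ : ℝ}
    (hball : Metric.closedBall p ρ ⊆ K) (hρ : η < ρ / 2) (k : Fin d) :
    coordWidth K k ≤ 2 * boxEdge v k + 4 * η := by
  obtain ⟨x, hx, y, hy, -, hw⟩ := exists_sub_eq_coordWidth h.isCompact h.nonempty_cell k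
  obtain ⟨x', hx', hxx⟩ := h.exists_near hQ.η_pos.le hQ.fill hρ
    (closedBall_half_subset h.convex hball hx)
  obtain ⟨y', hy', hyy⟩ := h.exists_near hQ.η_pos.le hQ.fill hρ
    (closedBall_half_subset h.convex hball hy)
  have h1 := abs_le.1 ((abs_coord_sub_le_dist _ _ k).trans hxx)
  have h2 := abs_le.1 ((abs_coord_sub_le_dist _ _ k).trans hyy)
  have h3 := sub_le_coordWidth (i := k) v.finite_toSet.isBounded hx' hy'
  rw [← boxEdge_eq_coordWidth] at h3
  simp only [PiLp.add_apply, PiLp.smul_apply, smul_eq_mul] at h1 h2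
  linarith [h1.2, h2.1]

lemma ClusterCell.mul_coordWidth_le (hd : 1 ≤ d) (hQ : QuasiUniformIn Ω X z r D η q a c C P)
    (h : ClusterCell Ω X c v K) {k₀ : Fin d} (hmax : ∀ k, coordWidth K k ≤ coordWidth K k₀)
    (hM : C * η ≤ coordWidth K k₀) (hs : s.Nonempty) (hsv : s ⊆ v) (hcard : v.card ≤ 4 * s.card)
    {i : Fin d} (hi : ∀ k, boxEdge v k ≤ boxEdge v i) {K' : Set (EuclideanSpace ℝ (Fin d))}
    (hK' : Bornology.IsBounded K') (hsK' : (s : Set (EuclideanSpace ℝ (Fin d))) ⊆ K')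
    (k : Fin d) : c * coordWidth K k ≤ coordWidth K' i := by
  obtain ⟨p, hball, hρ⟩ := h.exists_ball hd hQ hM
  have hP := hQ.one_le_P
  have hη := hQ.η_pos
  have hslab := coordWidth_le_of_card_le hd h.isCompact h.convex hball (s := s) hη hQ.one_le_a
    hQ.η_le (fun x hx => h.exists_near hη.le hQ.fill hρ hx) hs (fun x hx => h.subset (hsv hx))
    (fun x hx y hy => hQ.sep x (h.subset_points (hsv hx)) y (h.subset_points (hsv hy))) hcard
    (i := i) (fun x hx y hy => abs_sub_le_coordWidth hK' (hsK' hx) (hsK' hy)) hQ.P_ge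
  have h1 := h.coordWidth_le_boxEdge hQ hball hρ k₀
  have h2 : boxEdge v i ≤ coordWidth K i :=
    coordWidth_mono h.isCompact.isBounded (Finset.coe_nonempty.2 h.nonempty) h.subset
  have h3 := hi k₀
  have h4 : 192 * P * η ≤ coordWidth K k₀ :=
    le_trans (mul_le_mul_of_nonneg_right hQ.P_le_C hη.le) hM
  have h5 : η ≤ P * η := le_mul_of_one_le_left hη.le hP
  have h6 : coordWidth K k₀ ≤ 192 * P * coordWidth K' i := by linarith
  calc c * coordWidth K k ≤ c * (192 * P * coordWidth K' i) :=
        mul_le_mul_of_nonneg_left ((hmax k).trans h6) hQ.c_pos.le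
    _ = (192 * P * c) * coordWidth K' i := by ring
    _ ≤ 1 * coordWidth K' i := by
        have : 0 ≤ coordWidth K' i :=
          coordWidth_nonneg hK' ((Finset.coe_nonempty.2 hs).mono hsK')
        have := hQ.c_mul_P_le
        gcongr
    _ = _ := one_mul _

lemma ClusterCell.split (hd : 1 ≤ d) (hQ : QuasiUniformIn Ω X z r D η q a c C P)
    (h : ClusterCell Ω X c v K) {k₀ : Fin d} (hmax : ∀ k, coordWidth K k ≤ coordWidth K k₀)
    (hM : C * η ≤ coordWidth K k₀) (hsplit : IsLongestEdgeSplit v s₁ s₂) :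
    (∃ K', ClusterCell Ω X c s₁ K') ∧ ∃ K', ClusterCell Ω X c s₂ K' := by
  obtain ⟨i, m, hi, h1, h2⟩ := hsplit.separated
  have hc := hsplit.card_add
  have hc1 := hsplit.card₁
  have hc2 := hsplit.card₂
  have hp1 := hsplit.nonempty₁.card_pos
  have hp2 := hsplit.nonempty₂.card_pos
  have hor : ∀ x ∈ v, x ∈ s₁ ∨ x ∈ s₂ := by
    intro x hx
    have : x ∈ (s₁ : Set (EuclideanSpace ℝ (Fin d))) ∪ s₂ := by rw [hsplit.union]; exact hx
    exact this
  have hb := h.isCompact.isBounded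
  refine ⟨⟨K ∩ {x | x i ∈ Set.Ici m}, h.child hQ.c_pos.le hsplit.nonempty₁ hsplit.subset₁
    Set.ordConnected_Ici isClosed_Ici h1 ?_ ?_⟩, ⟨K ∩ {x | x i ∈ Set.Iic m},
    h.child hQ.c_pos.le hsplit.nonempty₂ hsplit.subset₂
    Set.ordConnected_Iic isClosed_Iic h2 ?_ ?_⟩⟩
  · exact fun x hx hxs => Or.inl fun t ht => (h2 x ((hor x hx).resolve_left hxs)).trans ht
  -- A nonempty son has at least a quarter of the points: `|v| ≤ 2|s| + 2 ≤ 4|s|`.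
  · exact h.mul_coordWidth_le hd hQ hmax hM hsplit.nonempty₁ hsplit.subset₁ (by omega) hi
      (hb.subset Set.inter_subset_left) fun x hx => ⟨h.subset (hsplit.subset₁ hx), h1 x hx⟩
  · exact fun x hx hxs => Or.inr fun t ht => le_trans ht (h1 x ((hor x hx).resolve_right hxs))
  · exact h.mul_coordWidth_le hd hQ hmax hM hsplit.nonempty₂ hsplit.subset₂ (by omega) hi
      (hb.subset Set.inter_subset_left) fun x hx => ⟨h.subset (hsplit.subset₂ hx), h2 x hx⟩

lemma diam_le_of_coordWidth_le {K : Set (EuclideanSpace ℝ (Fin d))} (hK : Bornology.IsBounded K)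
    {M : ℝ} (hw : ∀ k, coordWidth K k ≤ M) (hne : K.Nonempty) (hM : 0 ≤ M) :
    Metric.diam K ≤ d * M := by
  refine (diam_le_sqrt_sum_coordWidth hK).trans ?_
  rw [Real.sqrt_le_left (by positivity), mul_pow]
  calc ∑ k, coordWidth K k ^ 2 ≤ ∑ _k : Fin d, M ^ 2 :=
        Finset.sum_le_sum fun k _ => pow_le_pow_left₀ (coordWidth_nonneg hK hne) (hw k) 2
    _ = d * M ^ 2 := by simp
    _ ≤ (d : ℝ) ^ 2 * M ^ 2 := by
        gcongr
        exact_mod_cast Nat.le_self_pow two_ne_zero d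

/-- Once a cell is narrower than `C * η`, the slab argument stops, but all descendants are already
small. -/
lemma ClusterTree.SplitsLongestEdges.diam_le_or_exists_cell {T : ClusterTree d} (hd : 1 ≤ d)
    (hQ : QuasiUniformIn Ω X z r D η q a c C P) (hT : T.SplitsLongestEdges)
    (hcell : ∃ K, ClusterCell Ω X c T.root K) :
    ∀ {j : ℕ} {v : Finset (EuclideanSpace ℝ (Fin d))}, v ∈ T.level j →
      Metric.diam (v : Set (EuclideanSpace ℝ (Fin d))) ≤ d * (C * η) ∨
        ∃ K, ClusterCell Ω X c v K := by
  induction T with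
  | leaf u =>
    intro j v hv
    cases j with
    | zero => rw [Multiset.mem_singleton.1 hv]; exact Or.inr hcell
    | succ j => simp [level] at hv
  | node u t₁ t₂ ih₁ ih₂ =>
    intro j v hv
    cases j with
    | zero => rw [Multiset.mem_singleton.1 hv]; exact Or.inr hcell
    | succ j =>
      obtain ⟨K, hK⟩ := hcell
      have : Nonempty (Fin d) := ⟨⟨0, hd⟩⟩
      obtain ⟨k₀, hk₀⟩ := Finite.exists_max fun k => coordWidth K k
      rcases le_or_gt (C * η) (coordWidth K k₀) with hM | hM
      · have hs := hK.split hd hQ hk₀ hM hT.1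
        rcases Multiset.mem_add.1 hv with h | h
        · exact ih₁ hT.2.1 hs.1 h
        · exact ih₂ hT.2.2 hs.2 h
      · left
        have hvK : (v : Set (EuclideanSpace ℝ (Fin d))) ⊆ K := fun x hx =>
          hK.subset (SplitsLongestEdges.subset_root (T := .node u t₁ t₂) hT hv hx)
        refine (Metric.diam_mono hvK hK.isCompact.isBounded).trans ?_
        exact diam_le_of_coordWidth_le hK.isCompact.isBounded
          (fun k => (hk₀ k).trans hM.le) hK.nonempty_cell (mul_pos hQ.C_pos hQ.η_pos).le

/-- A cluster whose cell is not small contains at least about `(diam v / η) ^ d` points. -/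
lemma ClusterCell.diam_le_of_card (hd : 1 ≤ d) (hQ : QuasiUniformIn Ω X z r D η q a c C P)
    (h : ClusterCell Ω X c v K) :
    Metric.diam (v : Set (EuclideanSpace ℝ (Fin d))) ≤ d * (C * η) ∨
      (r / (4 * d ^ 2 * D) * (c / (2 * d)) ^ d *
        Metric.diam (v : Set (EuclideanSpace ℝ (Fin d)))) ^ d ≤ v.card * η ^ d := by
  have : Nonempty (Fin d) := ⟨⟨0, hd⟩⟩
  have hdpos : (0 : ℝ) < d := by exact_mod_cast hd
  have hd1 : (1 : ℝ) ≤ d := by exact_mod_cast hd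
  have hc := hQ.c_pos
  have hD := hQ.D_pos
  have hr := hQ.r_pos
  have hη := hQ.η_pos
  obtain ⟨k₀, hk₀⟩ := Finite.exists_max fun k => coordWidth K k
  have hb := h.isCompact.isBounded
  have hdiam : ∀ M, 0 ≤ M → coordWidth K k₀ ≤ M →
      Metric.diam (v : Set (EuclideanSpace ℝ (Fin d))) ≤ d * M := fun M hM0 hM =>
    (Metric.diam_mono h.subset hb).trans
      (diam_le_of_coordWidth_le hb (fun k => (hk₀ k).trans hM) h.nonempty_cell hM0)
  rcases le_or_gt (C * η) (coordWidth K k₀) with hM | hM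
  · right
    have hw0 : 0 ≤ coordWidth K k₀ := coordWidth_nonneg hb h.nonempty_cell
    obtain ⟨p, hball, hρ⟩ := h.exists_ball hd hQ hM
    set ρ := (c / (2 * d)) ^ d * coordWidth K k₀ / (2 * d * D) * r
    refine le_trans ?_ (pow_le_card_mul_pow_of_cover (R := ρ / 2) (p := p) hη.le
      (by positivity) ?_)
    · refine pow_le_pow_left₀ (by positivity) ?_ d
      have h1 := hdiam _ hw0 le_rfl
      calc r / (4 * d ^ 2 * D) * (c / (2 * d)) ^ d *
            Metric.diam (v : Set (EuclideanSpace ℝ (Fin d)))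
          ≤ r / (4 * d ^ 2 * D) * (c / (2 * d)) ^ d * (d * coordWidth K k₀) := by gcongr
        _ = ρ / 2 := by simp only [ρ]; field_simp; norm_num
    · intro y hy
      refine h.exists_near hη.le hQ.fill hρ ((Metric.closedBall_subset_closedBall' ?_).trans hball)
      linarith
  · exact Or.inl (hdiam _ (mul_pos hQ.C_pos hη).le hM.le)

end QuasiUniform
end

noncomputable section

/-! ### The upper bound, with and without interior -/

section UpperBound
variable {d : ℕ} {Ω : Set (EuclideanSpace ℝ (Fin d))} {X : Finset (EuclideanSpace ℝ (Fin d))}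

lemma exists_dist_le_fillDist (hb : Bornology.IsBounded Ω) (hX : X.Nonempty)
    {x : EuclideanSpace ℝ (Fin d)} (hx : x ∈ closure Ω) : ∃ y ∈ X, dist x y ≤ fillDist X Ω := by
  have hXne : (X : Set (EuclideanSpace ℝ (Fin d))).Nonempty := hX
  have hbdd : BddAbove ((fun x => Metric.infDist x (X : Set (EuclideanSpace ℝ (Fin d)))) '' Ω) :=
    ((Metric.lipschitz_infDist_pt _).isBounded_image hb).bddAbove
  have hle : Metric.infDist x (X : Set (EuclideanSpace ℝ (Fin d))) ≤ fillDist X Ω :=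
    closure_minimal (fun y hy => le_csSup hbdd ⟨y, hy, rfl⟩)
      (isClosed_le (Metric.continuous_infDist_pt _) continuous_const) hx
  obtain ⟨y, hy, hxy⟩ := X.finite_toSet.isCompact.exists_infDist_eq_dist hXne x
  exact ⟨y, hy, hxy ▸ hle⟩

lemma fillDist_nonneg : 0 ≤ fillDist X Ω :=
  Real.sSup_nonneg (by rintro _ ⟨x, -, rfl⟩; exact Metric.infDist_nonneg)

lemma rpow_neg_inv_pow (hd : 1 ≤ d) {x : ℝ} (hx : 0 ≤ x) : (x ^ (-(1 / (d : ℝ)))) ^ d = x⁻¹ := by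
  have hdpos : (0 : ℝ) < d := by exact_mod_cast hd
  rw [← Real.rpow_natCast, ← Real.rpow_mul hx, neg_mul, one_div_mul_cancel hdpos.ne',
    Real.rpow_neg_one]

lemma two_rpow_neg_div_pow (hd : 1 ≤ d) (j : ℕ) :
    ((2 : ℝ) ^ (-((j : ℝ) / (d : ℝ)))) ^ d = (2 ^ j)⁻¹ := by
  have hdpos : (0 : ℝ) < d := by exact_mod_cast hd
  rw [← Real.rpow_natCast, ← Real.rpow_mul (by norm_num), neg_mul, div_mul_cancel₀ _ hdpos.ne',
    Real.rpow_neg (by norm_num), Real.rpow_natCast]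

lemma card_rpow_le_of_two_pow_le (hd : 1 ≤ d) {N j : ℕ} (hN : 0 < N) (h : 2 ^ j ≤ 2 * N) :
    (N : ℝ) ^ (-(1 / (d : ℝ))) ≤ 2 * (2 : ℝ) ^ (-((j : ℝ) / (d : ℝ))) := by
  have hN' : (0 : ℝ) < N := by exact_mod_cast hN
  have h' : (2 : ℝ) ^ j ≤ 2 * N := by exact_mod_cast h
  refine le_of_pow_le_pow_left₀ (by omega : d ≠ 0) (by positivity) ?_
  rw [mul_pow, rpow_neg_inv_pow hd hN'.le, two_rpow_neg_div_pow hd]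
  have h2 : (2 : ℝ) ≤ 2 ^ d := le_self_pow₀ (by norm_num) (by omega)
  calc (N : ℝ)⁻¹ ≤ 2 * (2 ^ j)⁻¹ := by
        rw [← div_eq_mul_inv, inv_le_comm₀ hN' (by positivity), inv_div, div_le_iff₀ two_pos]
        linarith
    _ ≤ _ := by gcongr

/-- The consequences of `q_X ∼ h_{X,Ω} ∼ N^{-1/d}` that the diameter bounds rely on. -/
lemma comparable_bounds {a : ℝ} (hX : X.Nonempty)
    (h₁ : ComparableWith a (sepRadius X) (fillDist X Ω))
    (h₂ : ComparableWith a (fillDist X Ω) ((X.card : ℝ) ^ (-(1 / (d : ℝ))))) :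
    0 < fillDist X Ω ∧ 1 ≤ a := by
  have hN : (0 : ℝ) < X.card := by exact_mod_cast hX.card_pos
  have hn : 0 < (X.card : ℝ) ^ (-(1 / (d : ℝ))) := by positivity
  have hf := fillDist_nonneg (X := X) (Ω := Ω)
  have hpos : 0 < fillDist X Ω := by
    refine hf.lt_of_ne fun h => ?_
    have := h₂.2
    rw [← h] at this
    linarith
  refine ⟨hpos, ?_⟩
  by_contra! ha
  have ha0 : 0 < a := by
    by_contra! hc
    nlinarith [h₂.2]
  have h3 : sepRadius X ≤ a * fillDist X Ω := h₁.1
  have h4 : fillDist X Ω ≤ a * (a * fillDist X Ω) :=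
    h₁.2.trans (mul_le_mul_of_nonneg_left h3 ha0.le)
  have h5 : a * fillDist X Ω < fillDist X Ω := mul_lt_of_lt_one_left hpos ha
  have h6 : a * (a * fillDist X Ω) < a * fillDist X Ω := mul_lt_mul_of_pos_left h5 ha0
  linarith

lemma exists_diam_le_of_interior_nonempty (hd : 1 ≤ d) (hconv : Convex ℝ Ω)
    (hb : Bornology.IsBounded Ω) (hint : (interior (closure Ω)).Nonempty) (a : ℝ) :
    ∃ C₃ : ℝ, 0 < C₃ ∧ ∀ X : Finset (EuclideanSpace ℝ (Fin d)), X.Nonempty →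
      (X : Set (EuclideanSpace ℝ (Fin d))) ⊆ Ω →
      ComparableWith a (sepRadius X) (fillDist X Ω) →
      ComparableWith a (fillDist X Ω) ((X.card : ℝ) ^ (-(1 / (d : ℝ)))) →
      ∀ T : ClusterTree d, T.IsBalancedTreeOn X → ∀ j : ℕ, ∀ v ∈ T.level j, 1 < v.card →
        Metric.diam (v : Set (EuclideanSpace ℝ (Fin d))) ≤
          C₃ * (2 : ℝ) ^ (-((j : ℝ) / (d : ℝ))) := by
  have hdpos : (0 : ℝ) < d := by exact_mod_cast hd
  rcases lt_or_ge a 1 with ha | ha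
  · exact ⟨1, one_pos, fun X hX _ h₁ h₂ => absurd (comparable_bounds hX h₁ h₂).2 (by linarith)⟩
  obtain ⟨z, hz⟩ := hint
  obtain ⟨r, hr, hball⟩ := Metric.nhds_basis_closedBall.mem_iff.1 (mem_interior_iff_mem_nhds.1 hz)
  have hcomp : IsCompact (closure Ω) := hb.isCompact_closure
  obtain ⟨P, hP⟩ := exists_nat_ge ((4 * a + 1) ^ d)
  have hP1 : (1 : ℝ) ≤ P := (one_le_pow₀ (by linarith)).trans hP
  set D := Metric.diam (closure Ω) + 1
  have hD : 0 < D := by have := Metric.diam_nonneg (s := closure Ω); positivity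
  set c : ℝ := min (1 / (192 * P)) (r / D)
  have hc : 0 < c := by positivity
  set κ := (c / (2 * d)) ^ d
  have hκ : 0 < κ := by positivity
  set C : ℝ := max (192 * P) (3 * (2 * d * D) / (κ * r))
  have hC : 0 < C := lt_max_of_lt_left (by positivity)
  set G := r / (4 * d ^ 2 * D) * κ
  have hG : 0 < G := by positivity
  -- The first summand serves small clusters, through `η ≤ 2 a t`; the second serves clusters in
  -- large cells, through `|v| ≤ 5N / 2^j`.
  refine ⟨d * C * (2 * a) + 5 * a / G, by positivity, ?_⟩
  intro X hX hXΩ h₁ h₂ T hT j v hv hcard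
  obtain ⟨hη, -⟩ := comparable_bounds hX h₁ h₂
  set η := fillDist X Ω
  have hQ : QuasiUniformIn (closure Ω) X z r D η (sepRadius X) a c C P :=
    { isCompact := hcomp
      convex := hconv.closure
      subset := hXΩ.trans subset_closure
      r_pos := hr
      ball := hball
      D_pos := hD
      dist_le := fun x hx y hy => (Metric.dist_le_diam_of_mem hcomp.isBounded hx hy).trans
        (by simp [D])
      η_pos := hη
      one_le_a := ha
      η_le := h₁.2
      sep := fun x hx y hy hxy => two_mul_sepRadius_le_dist hx hy hxy
      fill := fun x hx => exists_dist_le_fillDist hb hX hx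
      P_ge := hP
      c_pos := hc
      c_mul_P_le := by
        calc 192 * P * c ≤ 192 * P * (1 / (192 * P)) := by gcongr; exact min_le_left _ _
          _ = 1 := by field_simp
      c_mul_D_le := by
        calc c * D ≤ r / D * D := by gcongr; exact min_le_right _ _
          _ = r := by field_simp
      P_le_C := le_max_left _ _
      lt_C_mul := by
        calc (2 : ℝ) < 3 := by norm_num
          _ = κ * (3 * (2 * d * D) / (κ * r)) / (2 * d * D) * r := by field_simp
          _ ≤ κ * C / (2 * d * D) * r := by gcongr; exact le_max_right _ _ }
  have hN : 0 < X.card := hX.card_pos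
  have hN' : (0 : ℝ) < X.card := by exact_mod_cast hN
  have hpow : 2 ^ j ≤ 2 * X.card := hT.root_eq ▸ hT.splits.two_pow_le hv hcard
  set t := (2 : ℝ) ^ (-((j : ℝ) / (d : ℝ)))
  have ht : 0 < t := by positivity
  have hηt : η ≤ 2 * a * t :=
    calc η ≤ a * (X.card : ℝ) ^ (-(1 / (d : ℝ))) := h₂.1
      _ ≤ a * (2 * t) := by gcongr; exact card_rpow_le_of_two_pow_le hd hN hpow
      _ = 2 * a * t := by ring
  have hG' : 0 ≤ 5 * a / G * t := by positivity
  have hC' : 0 ≤ d * C * (2 * a) * t := by positivity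
  have hsmall : d * (C * η) ≤ (d * C * (2 * a) + 5 * a / G) * t :=
    calc d * (C * η) ≤ d * (C * (2 * a * t)) := by gcongr
      _ ≤ _ := by linarith
  have hcell : ∃ K, ClusterCell (closure Ω) X c T.root K :=
    ⟨closure Ω, hT.root_eq.symm ▸ hQ.root hX⟩
  rcases hT.splits.diam_le_or_exists_cell hd hQ hcell hv with h | ⟨K, hK⟩
  · exact h.trans hsmall
  rcases hK.diam_le_of_card hd hQ with h | h
  · exact h.trans hsmall
  have hvcard : (v.card : ℝ) ≤ 5 * X.card * (2 ^ j)⁻¹ := by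
    have h1 := hT.splits.card_le hv
    rw [hT.root_eq] at h1
    have h2 : v.card * 2 ^ j ≤ 5 * X.card := by rw [mul_comm]; omega
    rw [← div_eq_mul_inv, le_div_iff₀ (by positivity)]
    exact_mod_cast h2
  have hηd : η ^ d ≤ a ^ d * (X.card : ℝ)⁻¹ := by
    have := pow_le_pow_left₀ hη.le h₂.1 d
    rwa [mul_pow, rpow_neg_inv_pow hd hN'.le] at this
  have h5 : (5 : ℝ) ≤ 5 ^ d := le_self_pow₀ (by norm_num) (by omega)
  have hfin : G * Metric.diam (v : Set (EuclideanSpace ℝ (Fin d))) ≤ 5 * a * t := by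
    refine le_of_pow_le_pow_left₀ (by omega : d ≠ 0) (by positivity) (h.trans ?_)
    calc (v.card : ℝ) * η ^ d ≤ (5 * X.card * (2 ^ j)⁻¹) * (a ^ d * (X.card : ℝ)⁻¹) := by gcongr
      _ = 5 * a ^ d * (2 ^ j)⁻¹ := by field_simp
      _ ≤ 5 ^ d * a ^ d * (2 ^ j)⁻¹ := by gcongr
      _ = (5 * a * t) ^ d := by rw [mul_pow, mul_pow, two_rpow_neg_div_pow hd]
  calc Metric.diam (v : Set (EuclideanSpace ℝ (Fin d))) ≤ 5 * a * t / G := by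
        rw [le_div_iff₀ hG]; linarith
    _ = 5 * a / G * t := by ring
    _ ≤ _ := by linarith

open MeasureTheory in
/-- In a convex set without interior, only small sets of points are quasi-uniform. -/
lemma exists_diam_le_of_interior_empty (hd : 1 ≤ d) (hconv : Convex ℝ Ω)
    (hb : Bornology.IsBounded Ω) (hint : interior (closure Ω) = ∅) (a : ℝ) :
    ∃ C₃ : ℝ, 0 < C₃ ∧ ∀ X : Finset (EuclideanSpace ℝ (Fin d)), X.Nonempty →
      (X : Set (EuclideanSpace ℝ (Fin d))) ⊆ Ω →
      ComparableWith a (sepRadius X) (fillDist X Ω) →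
      ComparableWith a (fillDist X Ω) ((X.card : ℝ) ^ (-(1 / (d : ℝ)))) →
      ∀ T : ClusterTree d, T.IsBalancedTreeOn X → ∀ j : ℕ, ∀ v ∈ T.level j, 1 < v.card →
        Metric.diam (v : Set (EuclideanSpace ℝ (Fin d))) ≤
          C₃ * (2 : ℝ) ^ (-((j : ℝ) / (d : ℝ))) := by
  rcases lt_or_ge a 1 with ha | ha
  · exact ⟨1, one_pos, fun X hX _ h₁ h₂ => absurd (comparable_bounds hX h₁ h₂).2 (by linarith)⟩
  have ha0 : 0 < a := by linarith
  -- Without interior the closure is its own frontier, which is null for a convex set; its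
  -- thickenings then have small volume.
  have hvol : volume (closure Ω) = 0 := by
    have h1 := hconv.closure.addHaar_frontier volume
    rwa [frontier, hint, Set.sdiff_empty, closure_closure] at h1
  have htend := tendsto_measure_cthickening_of_isClosed (μ := volume) (s := closure Ω)
    ⟨1, one_pos, hb.closure.cthickening.measure_lt_top.ne⟩ isClosed_closure
  rw [hvol] at htend
  have hpos : 0 < ENNReal.ofReal (((a ^ 2)⁻¹) ^ d) *
      volume (Metric.ball (0 : EuclideanSpace ℝ (Fin d)) 1) :=
    ENNReal.mul_pos (by simpa using by positivity) volume_unitBall_pos.ne'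
  obtain ⟨q₀, hq₀, hlt⟩ : ∃ q₀ > 0, volume (Metric.cthickening q₀ (closure Ω)) <
      ENNReal.ofReal (((a ^ 2)⁻¹) ^ d) *
        volume (Metric.ball (0 : EuclideanSpace ℝ (Fin d)) 1) := by
    obtain ⟨ε, hε, h⟩ := Metric.eventually_nhds_iff.1 (htend.eventually_lt_const hpos)
    exact ⟨ε / 2, by positivity, h (by rw [dist_zero_right, Real.norm_of_nonneg] <;> linarith)⟩
  refine ⟨2 * a ^ 2 / q₀ * (Metric.diam Ω + 1),
    mul_pos (by positivity) (by have := Metric.diam_nonneg (s := Ω); positivity), ?_⟩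
  intro X hX hXΩ h₁ h₂ T hT j v hv hcard
  have hN : 0 < X.card := hX.card_pos
  have hN' : (0 : ℝ) < X.card := by exact_mod_cast hN
  set n := (X.card : ℝ) ^ (-(1 / (d : ℝ))) with hn
  have hn0 : 0 < n := by positivity
  set q := sepRadius X
  have hq0 : 0 ≤ q := sepRadius_nonneg X
  have hnq : (a ^ 2)⁻¹ * n ≤ q := by
    rw [inv_mul_le_iff₀ (by positivity)]
    calc n ≤ a * fillDist X Ω := h₂.2
      _ ≤ a * (a * q) := mul_le_mul_of_nonneg_left h₁.2 ha0.le
      _ = a ^ 2 * q := by ring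
  have hqn : q ≤ a ^ 2 * n :=
    calc q ≤ a * fillDist X Ω := h₁.1
      _ ≤ a * (a * n) := mul_le_mul_of_nonneg_left h₂.1 ha0.le
      _ = a ^ 2 * n := by ring
  -- Otherwise the balls of radius `q` around `X` would fit into the thin neighbourhood, yet `N q^d
  -- ≥ a^(-2d)` makes their total volume too large.
  have hq₀q : q₀ ≤ q := by
    by_contra! hc
    have h1 := card_mul_pow_mul_volume_le (s := X) hq0
      (fun x hx y hy hxy => two_mul_sepRadius_le_dist hx hy hxy)
      (A := Metric.cthickening q₀ (closure Ω))
      (fun x hx => (Metric.closedBall_subset_cthickening (subset_closure (hXΩ hx)) q).trans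
        (Metric.cthickening_mono hc.le _)) hd
    refine absurd (h1.trans_lt hlt) (not_lt.2 ?_)
    refine mul_le_mul_left (ENNReal.ofReal_le_ofReal ?_) _
    have h2 := pow_le_pow_left₀ (by positivity) hnq d
    rw [mul_pow, hn, rpow_neg_inv_pow hd hN'.le, ← div_eq_mul_inv, div_le_iff₀ hN'] at h2
    linarith
  have hpow : 2 ^ j ≤ 2 * X.card := hT.root_eq ▸ hT.splits.two_pow_le hv hcard
  have hnt := card_rpow_le_of_two_pow_le hd hN hpow
  rw [← hn] at hnt
  set t := (2 : ℝ) ^ (-((j : ℝ) / (d : ℝ)))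
  -- From `q₀ ≤ q ≤ a² n ≤ 2 a² t`: the level is bounded, so the diameter of `Ω` is an admissible
  -- bound up to a constant.
  have hone : 1 ≤ 2 * a ^ 2 / q₀ * t := by
    rw [div_mul_eq_mul_div, le_div_iff₀ hq₀]
    nlinarith [pow_pos ha0 2]
  have hvΩ : (v : Set (EuclideanSpace ℝ (Fin d))) ⊆ Ω := fun x hx =>
    hXΩ (hT.root_eq ▸ hT.splits.subset_root hv hx)
  have hdiam : Metric.diam (v : Set (EuclideanSpace ℝ (Fin d))) ≤ Metric.diam Ω + 1 :=
    (Metric.diam_mono hvΩ hb).trans (by linarith)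
  have h0 : 0 ≤ Metric.diam Ω + 1 := by have := Metric.diam_nonneg (s := Ω); positivity
  calc Metric.diam (v : Set (EuclideanSpace ℝ (Fin d))) ≤ 1 * (Metric.diam Ω + 1) := by linarith
    _ ≤ (2 * a ^ 2 / q₀ * t) * (Metric.diam Ω + 1) := by gcongr
    _ = _ := by ring

end UpperBound
end

theorem proposition4p2p6 (d : ℕ) (hd : 1 ≤ d) (Ω : Set (EuclideanSpace ℝ (Fin d))) :
    -- (1) lower bound for the diameter of a non-singleton cluster
    (∃ C₁ : ℝ, 0 < C₁ ∧ ∀ X : Finset (EuclideanSpace ℝ (Fin d)), X.Nonempty →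
      (X : Set (EuclideanSpace ℝ (Fin d))) ⊆ Ω →
      ∀ T : ClusterTree d, T.IsBalancedTreeOn X → ∀ j : ℕ, ∀ v ∈ T.level j, 1 < v.card →
        C₁ * (X.card : ℝ) ^ (1 / (d : ℝ)) * sepRadius X * (2 : ℝ) ^ (-((j : ℝ) / (d : ℝ))) ≤
          Metric.diam (v : Set (EuclideanSpace ℝ (Fin d)))) ∧
    -- (2) the sum of the diameters of all clusters on level `j`
    (Bornology.IsBounded Ω → ∀ X : Finset (EuclideanSpace ℝ (Fin d)), X.Nonempty →
      (X : Set (EuclideanSpace ℝ (Fin d))) ⊆ Ω →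
      ∀ T : ClusterTree d, T.IsBalancedTreeOn X → ∀ j : ℕ,
        ((T.level j).map
          (fun v : Finset (EuclideanSpace ℝ (Fin d)) => Metric.diam (v : Set (EuclideanSpace ℝ (Fin d))))).sum ≤
          2 * √(d : ℝ) * Metric.diam Ω * (2 : ℝ) ^ ((j : ℝ) - (j : ℝ) / (d : ℝ))) ∧
    -- (3) upper bound for quasi-uniform points in a bounded convex set
    (Convex ℝ Ω → Bornology.IsBounded Ω → ∀ a : ℝ,
      ∃ C₃ : ℝ, 0 < C₃ ∧ ∀ X : Finset (EuclideanSpace ℝ (Fin d)), X.Nonempty →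
        (X : Set (EuclideanSpace ℝ (Fin d))) ⊆ Ω →
        ComparableWith a (sepRadius X) (fillDist X Ω) →
        ComparableWith a (fillDist X Ω) ((X.card : ℝ) ^ (-(1 / (d : ℝ)))) →
        ∀ T : ClusterTree d, T.IsBalancedTreeOn X → ∀ j : ℕ, ∀ v ∈ T.level j, 1 < v.card →
          Metric.diam (v : Set (EuclideanSpace ℝ (Fin d))) ≤
            C₃ * (2 : ℝ) ^ (-((j : ℝ) / (d : ℝ)))) := by
  refine ⟨⟨1 / 3, by norm_num, fun X _ _ T hT j v hv hc => ?_⟩, fun hb X hX hXΩ T hT j => ?_,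
    fun hconv hb a => ?_⟩
  · have := hT.splits.le_diam hd hv hc
    rwa [hT.root_eq] at this
  · obtain ⟨rfl, hs⟩ := hT
    exact hs.sum_diam_le hd hX hb hXΩ j
  · rcases (interior (closure Ω)).eq_empty_or_nonempty with h | h
    · exact exists_diam_le_of_interior_empty hd hconv hb h a
    · exact exists_diam_le_of_interior_nonempty hd hconv hb h a
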